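/- Let $k$ be a perfect field with algebraic closure $\overline k$ and absolute Galois group $\mathfrak g_k=\mathrm{Gal}(\overline k/k)$; write $H^i(k,M)$ for the continuous cohomology of the discrete $\mathfrak g_k$-module $M$, and $\mathrm{Br}(k)=H^2(k,\mathbb G_m)=H^2(\mathfrak g_k,\overline k^{*})$. Let $n,g\ge 1$ be integers. An abstract theta group is an algebraic $k$-group scheme $\mathcal G$ in a short exact sequence $1\to\mathbb G_m\to\mathcal G\to K\to 0$ such that the center of $\mathcal G$ is $\mathbb G_m$, $K$ is finite étale with $K(\overline k)\cong A\oplus A$ for a finite abelian group $A$, and $\mathrm{char}(k)\nmid \#K(\overline k)$; it is of type $\underline n=(n,\dots,n)$ ($g$ entries) if $A\cong(\mathbb Z/n)^g$. Let $e:K\times K\to\mathbb G_m$, $e(P,P')=\tilde P\tilde P'\tilde P^{-1}\tilde P'^{-1}$ (with lifts $\tilde P,\tilde P'$ to $\mathcal G$), be the commutator pairing, and let $\Delta:H^1(k,K)\to H^2(k,\mathbb G_m)=\mathrm{Br}(k)$ be the obstruction (connecting) map, which sends the class of a cocycle $\xi$ to the class of $(\sigma,\tau)\mapsto N_\sigma\,\sigma(N_\tau)\,N_{\sigma\tau}^{-1}$,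 where $N_\sigma\in\mathcal G(\overline k)$ lifts $\xi(\sigma)$. Let $\mathcal G$ be an abstract theta group of type $\underline n$ that is Lagrangian, that is, $K=H\oplus H^{*}$ as $\mathfrak g_k$-modules with $H$ and $H^{*}$ isotropic for $e$, and suppose that $H\cong H^{*}\cong(\mathbb Z/n)^g$ are both constant (have trivial Galois action). Then: (1) $k$ contains a primitive $n$-th root of unity. (2) Let $\zeta\in k$ be any primitive $n$-th root of unity. For $a\in k^{*}/k^{*n}$ let $\chi_a:\mathfrak g_k\to\mathbb Z/n$ be the Kummer character, $\sigma(\alpha)=\zeta^{\chi_a(\sigma)}\alpha$ for $\alpha^n=a$, and let $\langle a,b\rangle_n\in\mathrm{Br}(k)$ be the norm-residue symbol attached to $\zeta$, i.e. the cup product $b\cup\delta\chi_a$, where $\chi_a$ is viewed in $H^1(k,\mathbb Q/\mathbb Z)$ via $i\mapsto i/n$ and $\delta:H^1(k,\mathbb Q/\mathbb Z)\to H^2(k,\mathbb Z)$ is the connecting map. Then $K(\overline k)$ has a $\zeta$-symplectic basis $x_1,\dots,x_g,y_1,\dots,y_g$ over $\mathbb Z/n$, meaning $e(x_i,x_j)=e(y_i,y_j)=1$,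 $e(x_i,y_i)=\zeta$ and $e(x_i,y_j)=1$ for $i\ne j$, with $x_i\in H$ and $y_i\in H^{*}$. (3) For every $\zeta$-symplectic basis of $K(\overline k)$, assigning to $(a_1,\dots,a_g,b_1,\dots,b_g)$ the class of the cocycle $\sigma\mapsto\sum_i\chi_{a_i}(\sigma)x_i+\sum_i\chi_{b_i}(\sigma)y_i$ is an isomorphism $(k^{*}/k^{*n})^{2g}\cong H^1(k,K)$; and, with this identification, there are $C_{1,i},C_{2,i}\in k^{*}/k^{*n}$ ($1\le i\le g$) such that for all $a_i,b_i\in k^{*}/k^{*n}$ $$\Delta(a_1,\dots,a_g,b_1,\dots,b_g)=\sum_{i=1}^g\Big(\langle C_{1,i}a_i,C_{2,i}b_i\rangle_n-\langle C_{1,i},C_{2,i}\rangle_n\Big)=\sum_{i=1}^g\langle a_i,b_i\rangle_n+\sum_{i=1}^g\Big(\langle C_{1,i},b_i\rangle_n+\langle a_i,C_{2,i}\rangle_n\Big).$$ -/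

import Mathlib

universe u

namespace GaloisCohomology

section Cochains

variable (Γ M : Type*) [Group Γ] [TopologicalSpace Γ] [CommGroup M] [MulDistribMulAction Γ M]

/-- Continuous (that is, locally constant) one-cocycles of `Γ` with values in a discrete
`Γ`-module `M`, written multiplicatively. -/
def Z1 : Subgroup (Γ → M) where
  carrier := {f | IsLocallyConstant f ∧ groupCohomology.IsMulCocycle₁ f}
  mul_mem' := by
    rintro f f' ⟨h, hc⟩ ⟨h', hc'⟩
    refine ⟨h.mul h', fun σ τ => ?_⟩
    simp only [Pi.mul_apply, hc σ τ, hc' σ τ, smul_mul']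
    exact mul_mul_mul_comm _ _ _ _
  one_mem' := ⟨IsLocallyConstant.one, fun σ τ => by simp⟩
  inv_mem' := by
    rintro f ⟨h, hc⟩
    refine ⟨h.inv, fun σ τ => ?_⟩
    simp only [Pi.inv_apply, hc σ τ, smul_inv', mul_inv]

/-- One-coboundaries `σ ↦ σ • x / x`. -/
def B1 : Subgroup (Γ → M) where
  carrier := {f | groupCohomology.IsMulCoboundary₁ f}
  mul_mem' := by
    rintro f f' ⟨x, h⟩ ⟨x', h'⟩
    refine ⟨x * x', fun σ => ?_⟩
    simp only [Pi.mul_apply, ← h, ← h', smul_mul']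
    exact mul_div_mul_comm _ _ _ _
  one_mem' := ⟨1, fun σ => by simp⟩
  inv_mem' := by
    rintro f ⟨x, h⟩
    refine ⟨x⁻¹, fun σ => ?_⟩
    simp only [Pi.inv_apply, ← h, smul_inv', inv_div_inv, inv_div]

/-- The continuous cohomology group `H¹(Γ, M)`. -/
abbrev H1 : Type _ := Z1 Γ M ⧸ (B1 Γ M).subgroupOf (Z1 Γ M)

/-- Continuous (locally constant) two-cocycles of `Γ` with values in the discrete module `M`. -/
def Z2 : Subgroup (Γ × Γ → M) where
  carrier := {f | IsLocallyConstant f ∧ groupCohomology.IsMulCocycle₂ f}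
  mul_mem' := by
    rintro f f' ⟨h, hc⟩ ⟨h', hc'⟩
    refine ⟨h.mul h', fun σ τ ρ => ?_⟩
    simp only [Pi.mul_apply, smul_mul']
    rw [mul_mul_mul_comm, hc σ τ ρ, hc' σ τ ρ, mul_mul_mul_comm]
  one_mem' := ⟨IsLocallyConstant.one, fun σ τ ρ => by simp⟩
  inv_mem' := by
    rintro f ⟨h, hc⟩
    refine ⟨h.inv, fun σ τ ρ => ?_⟩
    simp only [Pi.inv_apply, smul_inv', ← mul_inv, hc σ τ ρ]

/-- Two-coboundaries of continuous (locally constant) one-cochains. -/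
def B2 : Subgroup (Γ × Γ → M) where
  carrier := {f | ∃ x : Γ → M, IsLocallyConstant x ∧
    ∀ σ τ, σ • x τ / x (σ * τ) * x σ = f (σ, τ)}
  mul_mem' := by
    rintro f f' ⟨x, h, hx⟩ ⟨x', h', hx'⟩
    refine ⟨x * x', h.mul h', fun σ τ => ?_⟩
    simp only [Pi.mul_apply, ← hx, ← hx', smul_mul', mul_div_mul_comm]
    exact mul_mul_mul_comm _ _ _ _
  one_mem' := ⟨1, IsLocallyConstant.one, fun σ τ => by simp⟩
  inv_mem' := by
    rintro f ⟨x, h, hx⟩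
    refine ⟨x⁻¹, h.inv, fun σ τ => ?_⟩
    simp only [Pi.inv_apply, ← hx, smul_inv', mul_inv, inv_div_inv, inv_div]

/-- The continuous cohomology group `H²(Γ, M)`. -/
abbrev H2 : Type _ := Z2 Γ M ⧸ (B2 Γ M).subgroupOf (Z2 Γ M)

end Cochains

section Connecting

/-- A central extension `1 → C → E → Q → 1` of discrete `Γ`-groups. -/
structure CentralExtension (Γ C E Q : Type*) [Group Γ] [TopologicalSpace Γ]
    [CommGroup C] [Group E] [CommGroup Q] [MulDistribMulAction Γ C] [MulDistribMulAction Γ E]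
    [MulDistribMulAction Γ Q] where
  /-- the inclusion of the central subgroup -/
  incl : C →* E
  /-- the projection onto the quotient -/
  proj : E →* Q
  incl_injective : Function.Injective incl
  proj_surjective : Function.Surjective proj
  exact : incl.range = proj.ker
  central : ∀ c e, incl c * e = e * incl c
  incl_smul : ∀ (σ : Γ) c, incl (σ • c) = σ • incl c
  proj_smul : ∀ (σ : Γ) e, proj (σ • e) = σ • proj e
  isLocallyConstant_smul : ∀ e : E, IsLocallyConstant fun σ : Γ => σ • e

namespace CentralExtension

variable {Γ C E Q : Type*} [Group Γ] [TopologicalSpace Γ]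
  [CommGroup C] [Group E] [CommGroup Q] [MulDistribMulAction Γ C] [MulDistribMulAction Γ E]
  [MulDistribMulAction Γ Q] (X : CentralExtension Γ C E Q)

/-- The two-cochain `c` of `C` is the coboundary of the one-cochain `N` of `E`. -/
def IsBoundaryOf (c : Γ × Γ → C) (N : Γ → E) : Prop :=
  ∀ σ τ, X.incl (c (σ, τ)) = N σ * σ • N τ * (N (σ * τ))⁻¹

theorem exists_of_proj_eq_one {e : E} (h : X.proj e = 1) : ∃ c, X.incl c = e := by
  have : e ∈ X.incl.range := by rw [X.exact]; exact h
  exact this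

theorem proj_incl (c : C) : X.proj (X.incl c) = 1 := by
  have : X.incl c ∈ X.proj.ker := by rw [← X.exact]; exact ⟨c, rfl⟩
  exact this

theorem mem_Z2_of_isBoundaryOf [IsTopologicalGroup Γ] {c : Γ × Γ → C} {N : Γ → E} (hN : IsLocallyConstant N)
    (h : X.IsBoundaryOf c N) : c ∈ Z2 Γ C := by
  constructor
  · rw [IsLocallyConstant.iff_eventually_eq]
    rintro ⟨σ, τ⟩
    have h1 : ∀ᶠ p in nhds (σ, τ), N p.1 = N σ :=
      (continuous_fst.tendsto (σ, τ)).eventually (hN.eventually_eq σ)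
    have h2 : ∀ᶠ p in nhds (σ, τ), N p.2 = N τ :=
      (continuous_snd.tendsto (σ, τ)).eventually (hN.eventually_eq τ)
    have h3 : ∀ᶠ p in nhds (σ, τ), N (p.1 * p.2) = N (σ * τ) :=
      (continuous_mul.tendsto (σ, τ)).eventually (hN.eventually_eq (σ * τ))
    have h4 : ∀ᶠ p in nhds (σ, τ), p.1 • N τ = σ • N τ :=
      (continuous_fst.tendsto (σ, τ)).eventually
        ((X.isLocallyConstant_smul (N τ)).eventually_eq σ)
    filter_upwards [h1, h2, h3, h4] with p e1 e2 e3 e4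
    apply X.incl_injective
    rw [h σ τ, h p.1 p.2, e1, e2, e3, e4]
  · intro σ τ ρ
    apply X.incl_injective
    have hc := X.central (c (σ * τ, ρ)) (X.incl (c (σ, τ)))
    have hd := X.central (σ • c (τ, ρ)) (N σ)
    rw [map_mul, map_mul, hc, h (σ * τ) ρ, h σ τ, h σ (τ * ρ)]
    rw [X.incl_smul, h τ ρ] at hd ⊢
    simp only [smul_mul', smul_inv', ← mul_smul] at hd ⊢
    rw [← mul_assoc (_ * _ * _) (N σ * _), ← mul_assoc (_ * _ * _) (N σ), hd]
    simp [mul_assoc]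

theorem mk_eq_of_isBoundaryOf {c c' : Z2 Γ C} {N N' : Γ → E} (hN : IsLocallyConstant N)
    (hN' : IsLocallyConstant N') (h : X.IsBoundaryOf c N) (h' : X.IsBoundaryOf c' N')
    (q : Q) (hq : ∀ σ, σ • q / q * X.proj (N σ) = X.proj (N' σ)) :
    (QuotientGroup.mk c : H2 Γ C) = QuotientGroup.mk c' := by
  obtain ⟨e, rfl⟩ := X.proj_surjective q
  have key : ∀ σ, ∃ x, X.incl x = N' σ * (e⁻¹ * N σ * σ • e)⁻¹ := fun σ => by
    apply X.exists_of_proj_eq_one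
    rw [map_mul, ← hq, map_inv, map_mul, map_mul, map_inv, X.proj_smul, mul_inv_eq_one,
      div_eq_mul_inv]
    exact mul_right_comm _ _ _ |>.trans (by rw [mul_comm, mul_assoc, mul_comm (X.proj (N σ)), mul_comm])
  choose x hx using key
  have hxl : IsLocallyConstant x := by
    refine IsLocallyConstant.desc x X.incl ?_ X.incl_injective
    have : X.incl ∘ x = N' * ((fun _ => e⁻¹) * N * fun σ => σ • e)⁻¹ := funext hx
    rw [this]
    exact hN'.mul (((IsLocallyConstant.const e⁻¹).mul hN).mul (X.isLocallyConstant_smul e)).inv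
  have hN'x : ∀ σ, N' σ = X.incl (x σ) * (e⁻¹ * N σ * σ • e) := fun σ => by
    rw [hx σ, inv_mul_cancel_right]
  rw [QuotientGroup.eq]
  refine ⟨x, hxl, fun σ τ => ?_⟩
  change _ = (c.1 (σ, τ))⁻¹ * c'.1 (σ, τ)
  rw [eq_inv_mul_iff_mul_eq]
  apply X.incl_injective
  rw [h' σ τ, hN'x, hN'x, hN'x]
  have hc := X.central (c.1 (σ, τ)) (e⁻¹)
  rw [h σ τ] at hc
  have e1 : e⁻¹ * N σ * σ • e * (σ • (e⁻¹ * N τ * τ • e)) * (e⁻¹ * N (σ * τ) * (σ * τ) • e)⁻¹ =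
      X.incl (c.1 (σ, τ)) := by
    rw [h σ τ]
    calc _ = e⁻¹ * (N σ * σ • N τ * (N (σ * τ))⁻¹) * e := by
          simp [smul_mul', smul_inv', mul_smul, mul_assoc]
      _ = _ := by rw [← hc]; simp
  have z1 := X.central (σ • x τ) (e⁻¹ * N σ * σ • e)
  have z2 := X.central (x (σ * τ))⁻¹ (e⁻¹ * N σ * σ • e * (σ • (e⁻¹ * N τ * τ • e)) *
    (e⁻¹ * N (σ * τ) * (σ * τ) • e)⁻¹)
  rw [e1] at z2
  rw [smul_mul', ← X.incl_smul, mul_inv_rev, ← map_inv]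
  calc X.incl (c.1 (σ, τ) * (σ • x τ / x (σ * τ) * x σ))
      = X.incl (x σ) * X.incl (σ • x τ) * (X.incl (c.1 (σ, τ)) * X.incl (x (σ * τ))⁻¹) := by
        rw [← map_mul, ← map_mul, ← map_mul]
        congr 1
        rw [div_eq_mul_inv, mul_comm (x σ)]
        simp only [mul_comm, mul_assoc]
    _ = X.incl (x σ) * (X.incl (σ • x τ) * (e⁻¹ * N σ * σ • e)) *
          (σ • (e⁻¹ * N τ * τ • e)) * (e⁻¹ * N (σ * τ) * (σ * τ) • e)⁻¹ *
            X.incl (x (σ * τ))⁻¹ := by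
        rw [← e1]; simp only [mul_assoc]
    _ = _ := by rw [z1]; simp only [mul_assoc]

/-- A set-theoretic lift along `proj`. -/
noncomputable def lift : Q → E := Function.surjInv X.proj_surjective

theorem proj_lift (q : Q) : X.proj (X.lift q) = q := Function.surjInv_eq X.proj_surjective q

theorem exists_incl_eq_boundary {N : Γ → E} (hN : groupCohomology.IsMulCocycle₁ (X.proj ∘ N))
    (σ τ : Γ) : ∃ c, X.incl c = N σ * σ • N τ * (N (σ * τ))⁻¹ := by
  apply X.exists_of_proj_eq_one
  have := hN σ τ
  simp only [Function.comp_apply] at this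
  rw [map_mul, map_mul, map_inv, X.proj_smul, this, mul_comm (X.proj (N σ))]
  exact mul_inv_cancel _

/-- The two-cocycle `(σ, τ) ↦ N_σ · σ(N_τ) · N_{στ}⁻¹`, where `N_σ` is the chosen lift of
`η(σ)`. -/
noncomputable def connectingCocycle [IsTopologicalGroup Γ] (η : Z1 Γ Q) : Z2 Γ C :=
  have hN : groupCohomology.IsMulCocycle₁ (X.proj ∘ fun σ => X.lift (η.1 σ)) := by
    simpa only [Function.comp_def, X.proj_lift] using η.2.2
  ⟨fun p => (X.exists_incl_eq_boundary hN p.1 p.2).choose,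
    X.mem_Z2_of_isBoundaryOf (η.2.1.comp X.lift) fun σ τ =>
      (X.exists_incl_eq_boundary hN σ τ).choose_spec⟩

theorem isBoundaryOf_connectingCocycle [IsTopologicalGroup Γ] (η : Z1 Γ Q) :
    X.IsBoundaryOf (X.connectingCocycle η) fun σ => X.lift (η.1 σ) := fun σ τ =>
  (X.exists_incl_eq_boundary (N := fun σ => X.lift (η.1 σ))
    (by simpa only [Function.comp_def, X.proj_lift] using η.2.2) σ τ).choose_spec

/-- The connecting map `H¹(Γ, Q) → H²(Γ, C)` of a central extension (a map of sets). -/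
noncomputable def connecting [IsTopologicalGroup Γ] : H1 Γ Q → H2 Γ C :=
  Quotient.lift (fun η => QuotientGroup.mk (X.connectingCocycle η)) fun η η' h => by
    obtain ⟨q, hq⟩ := QuotientGroup.leftRel_apply.mp h
    refine X.mk_eq_of_isBoundaryOf (η.2.1.comp X.lift) (η'.2.1.comp X.lift)
      (X.isBoundaryOf_connectingCocycle η) (X.isBoundaryOf_connectingCocycle η') q fun σ => ?_
    simp only [Function.comp_apply, X.proj_lift, hq]
    change (η.1 σ)⁻¹ * η'.1 σ * η.1 σ = η'.1 σ
    rw [mul_comm, mul_inv_cancel_left]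

theorem exists_incl_eq_commutator (P R : Q) :
    ∃ c, X.incl c = X.lift P * X.lift R * (X.lift P)⁻¹ * (X.lift R)⁻¹ := by
  apply X.exists_of_proj_eq_one
  simp only [map_mul, map_inv]
  rw [mul_inv_eq_one, mul_comm (X.proj (X.lift P)), mul_inv_cancel_right]

/-- The commutator pairing `Q × Q → C`: the commutator `a b a⁻¹ b⁻¹` of lifts to `E`. -/
noncomputable def commutatorPairing (P R : Q) : C := (X.exists_incl_eq_commutator P R).choose

/-- The commutator pairing does not depend on the lifts. -/
theorem incl_commutatorPairing (a b : E) :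
    X.incl (X.commutatorPairing (X.proj a) (X.proj b)) = a * b * a⁻¹ * b⁻¹ := by
  have hl : ∀ a, ∃ c, X.incl c = X.lift (X.proj a) * a⁻¹ := fun a => by
    apply X.exists_of_proj_eq_one
    rw [map_mul, X.proj_lift, map_inv, mul_inv_cancel]
  obtain ⟨c, hc⟩ := hl a
  obtain ⟨d, hd⟩ := hl b
  rw [eq_mul_inv_iff_mul_eq] at hc hd
  refine (X.exists_incl_eq_commutator _ _).choose_spec.trans ?_
  rw [← hc, ← hd, mul_inv_rev, mul_inv_rev, ← map_inv, ← map_inv]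
  have h1 := X.central d a
  have h2 := X.central c⁻¹ (X.incl c * a * (X.incl d * b) * a⁻¹)
  have h3 := X.central d⁻¹ (X.incl c * a * (X.incl d * b) * (a⁻¹ * X.incl c⁻¹) * b⁻¹)
  rw [← mul_assoc (_ * _ * _) b⁻¹, ← h3, ← mul_assoc (_ * _ * _) a⁻¹, ← h2,
    mul_assoc (X.incl c), ← mul_assoc a, ← h1, map_inv, map_inv]
  have h4 := X.central d⁻¹ (X.incl c)
  have h5 := X.central c (X.incl d)
  simp [mul_assoc]

end CentralExtension
end Connecting
end GaloisCohomology

namespace GaloisCohomology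

/-- `kˣ/kˣⁿ`. -/
abbrev UnitsModPow (k : Type*) [Field k] (n : ℕ) : Type _ := kˣ ⧸ (powMonoidHom n : kˣ →* kˣ).range

section NormResidue

variable (k kbar : Type*) [Field k] [Field kbar] [Algebra k kbar] [IsAlgClosure k kbar]

/-- The absolute Galois group of `k`, with the Krull topology. -/
abbrev AbsGal (k kbar : Type*) [Field k] [Field kbar] [Algebra k kbar] : Type _ := kbar ≃ₐ[k] kbar

/-- The Brauer group `Br(k) = H²(k, 𝔾ₘ)`, written additively. -/
abbrev Br (k kbar : Type*) [Field k] [Field kbar] [Algebra k kbar] : Type _ :=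
  Additive (H2 (AbsGal k kbar) kbarˣ)

/-- Continuous characters of a topological group with values in `ℤ/n`. -/
def Character (Γ : Type*) [Group Γ] [TopologicalSpace Γ] (n : ℕ) : Type _ :=
  {χ : Γ → ZMod n // IsLocallyConstant χ ∧ ∀ σ τ, χ (σ * τ) = χ σ + χ τ}

instance (Γ : Type*) [Group Γ] [TopologicalSpace Γ] (n : ℕ) :
    CoeFun (Character Γ n) fun _ => Γ → ZMod n := ⟨Subtype.val⟩

variable {k kbar} {n : ℕ} [NeZero n] {ζ : k}

theorem isLocallyConstant_apply (x : kbar) :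
    IsLocallyConstant fun σ : AbsGal k kbar => σ x := by
  have : Algebra.IsAlgebraic k kbar := IsAlgClosure.isAlgebraic
  rw [IsLocallyConstant.iff_isOpen_fiber_apply]
  intro σ
  convert! (stabilizer_isOpen_of_isIntegral (K := k) x).leftCoset σ using 1
  ext τ
  simp [Set.mem_smul_set_iff_inv_smul_mem, AlgEquiv.smul_def, AlgEquiv.mul_apply, eq_comm,
    AlgEquiv.eq_symm_apply, AlgEquiv.aut_inv]

/-- For `a ∈ kˣ` and `σ` there is an exponent `i ∈ ℤ/n` with `σ(α) = ζⁱ α` for all `n`-th roots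
`α` of `a` in `kbar`. -/
theorem exists_kummer_exponent (hζ : IsPrimitiveRoot ζ n) (a : kˣ) (σ : AbsGal k kbar) : ∃ i : ZMod n, ∀ α : kbar,
    α ^ n = algebraMap k kbar a → σ α = algebraMap k kbar ζ ^ i.val * α := by
  have : IsAlgClosed kbar := IsAlgClosure.isAlgClosed k
  have hn : 0 < n := Nat.pos_of_ne_zero (NeZero.ne n)
  have hζ' : IsPrimitiveRoot (algebraMap k kbar ζ) n :=
    hζ.map_of_injective (algebraMap k kbar).injective
  obtain ⟨α, hα⟩ := IsAlgClosed.exists_pow_nat_eq (algebraMap k kbar a) hn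
  have ha : algebraMap k kbar a ≠ 0 := by simp
  have hα0 : α ≠ 0 := by rintro rfl; rw [zero_pow hn.ne'] at hα; exact ha hα.symm
  obtain ⟨i, hi, h⟩ := hζ'.eq_pow_of_pow_eq_one (ξ := σ α / α) (by
    rw [div_pow, ← map_pow, hα, AlgEquiv.commutes, div_self ha])
  refine ⟨i, fun β hβ => ?_⟩
  obtain ⟨j, -, h'⟩ := hζ'.eq_pow_of_pow_eq_one (ξ := β / α) (by rw [div_pow, hα, hβ, div_self ha])
  rw [eq_div_iff hα0] at h h'
  rw [ZMod.val_natCast_of_lt hi, ← h', map_mul, map_pow, AlgEquiv.commutes, ← h]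
  ring

/-- The Kummer character `χ_a` of `a ∈ kˣ`, given by `σ(α) = ζ^{χ_a(σ)} α` where `αⁿ = a`. -/
noncomputable def kummerFun (hζ : IsPrimitiveRoot ζ n) (a : kˣ) (σ : AbsGal k kbar) : ZMod n :=
  (exists_kummer_exponent hζ a σ).choose

theorem kummerFun_spec (hζ : IsPrimitiveRoot ζ n) (a : kˣ) (σ : AbsGal k kbar) (α : kbar)
    (hα : α ^ n = algebraMap k kbar a) :
    σ α = algebraMap k kbar ζ ^ (kummerFun hζ a σ).val * α :=
  (exists_kummer_exponent hζ a σ).choose_spec α hα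

theorem kummerFun_eq_of (hζ : IsPrimitiveRoot ζ n) (a : kˣ) (σ : AbsGal k kbar) (α : kbar)
    (hα : α ^ n = algebraMap k kbar a) (i : ℕ) (h : σ α = algebraMap k kbar ζ ^ i * α) :
    kummerFun hζ a σ = i := by
  have hζ' : IsPrimitiveRoot (algebraMap k kbar ζ) n :=
    hζ.map_of_injective (algebraMap k kbar).injective
  have hα0 : α ≠ 0 := by
    rintro rfl
    rw [zero_pow (NeZero.ne n)] at hα
    exact a.ne_zero (by simpa using hα.symm)
  rw [kummerFun_spec hζ a σ α hα] at h
  have h := mul_right_cancel₀ hα0 h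
  rw [← ZMod.natCast_zmod_val (kummerFun hζ a σ), ZMod.natCast_eq_natCast_iff]
  have h := (hζ'.isOfFinOrder (NeZero.ne n)).pow_eq_pow_iff_modEq.mp h
  rwa [← hζ'.eq_orderOf] at h

/-- The Kummer character `χ_a` as a continuous character. -/
noncomputable def kummerUnit (hζ : IsPrimitiveRoot ζ n) (a : kˣ) :
    Character (AbsGal k kbar) n :=
  ⟨kummerFun hζ a, by
    have : IsAlgClosed kbar := IsAlgClosure.isAlgClosed k
    obtain ⟨α, hα⟩ := IsAlgClosed.exists_pow_nat_eq (algebraMap k kbar a) (NeZero.pos n)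
    constructor
    · rw [IsLocallyConstant.iff_eventually_eq]
      intro σ
      filter_upwards [(isLocallyConstant_apply (k := k) α).eventually_eq σ] with τ hτ
      rw [kummerFun_eq_of hζ a τ α hα _ (hτ.trans (kummerFun_spec hζ a σ α hα)),
        ZMod.natCast_zmod_val]
    · intro σ τ
      rw [kummerFun_eq_of hζ a (σ * τ) α hα
        ((kummerFun hζ a σ).val + (kummerFun hζ a τ).val)]
      · simp
      · rw [AlgEquiv.mul_apply, kummerFun_spec hζ a τ α hα, map_mul, map_pow, AlgEquiv.commutes,
          kummerFun_spec hζ a σ α hα]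
        ring⟩

/-- The Kummer character `χ_a` for `a ∈ kˣ/kˣⁿ`. -/
noncomputable def kummer (kbar : Type*) [Field kbar] [Algebra k kbar] [IsAlgClosure k kbar]
    (hζ : IsPrimitiveRoot ζ n) (a : UnitsModPow k n) : Character (AbsGal k kbar) n :=
  Quotient.liftOn' a (kummerUnit hζ) fun a b h => by
    obtain ⟨c, hc⟩ := QuotientGroup.leftRel_apply.mp h
    have : IsAlgClosed kbar := IsAlgClosure.isAlgClosed k
    obtain ⟨α, hα⟩ := IsAlgClosed.exists_pow_nat_eq (algebraMap k kbar a) (NeZero.pos n)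
    have hb : (α * algebraMap k kbar c) ^ n = algebraMap k kbar b := by
      rw [eq_inv_mul_iff_mul_eq] at hc
      rw [mul_pow, hα, ← hc]
      simp
    refine Subtype.ext (funext fun σ => ?_)
    change kummerFun hζ a σ = kummerFun hζ b σ
    rw [kummerFun_eq_of hζ b σ _ hb, ZMod.natCast_zmod_val]
    rw [map_mul, AlgEquiv.commutes, kummerFun_spec hζ a σ α hα]
    ring

/-- The two-cocycle `δχ` with integral values attached to a character `χ : Γ → ℤ/n`:
the coboundary of the lift of `χ/n` to `ℚ`. -/
def bockstein {Γ : Type*} [Group Γ] [TopologicalSpace Γ] {n : ℕ} (χ : Character Γ n)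
    (p : Γ × Γ) : ℤ :=
  (((χ p.1).val : ℤ) + (χ p.2).val - (χ (p.1 * p.2)).val) / n

theorem mul_bockstein {Γ : Type*} [Group Γ] [TopologicalSpace Γ] {n : ℕ} [NeZero n]
    (χ : Character Γ n) (σ τ : Γ) :
    n * bockstein χ (σ, τ) = ((χ σ).val : ℤ) + (χ τ).val - (χ (σ * τ)).val := by
  refine Int.mul_ediv_cancel' ?_
  rw [← ZMod.intCast_zmod_eq_zero_iff_dvd]
  simp [χ.2.2 σ τ]

/-- The image of `b ∈ kˣ` in the units of the algebraic closure. -/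
def toBarUnit (kbar : Type*) [Field kbar] [Algebra k kbar] : kˣ →* kbarˣ :=
  Units.map (algebraMap k kbar).toMonoidHom

theorem smul_toBarUnit {k kbar : Type*} [Field k] [Field kbar] [Algebra k kbar]
    (σ : AbsGal k kbar) (b : kˣ) : σ • toBarUnit kbar b = toBarUnit kbar b :=
  Units.ext (σ.commutes b)

/-- The two-cocycle `(σ, τ) ↦ b ^ δχ(σ, τ)`, which represents the cup product `b ∪ δχ`. -/
def symbolCocycle (χ : Character (AbsGal k kbar) n) (b : kˣ) :
    Z2 (AbsGal k kbar) kbarˣ :=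
  ⟨fun p => toBarUnit kbar b ^ bockstein χ p, by
    constructor
    · have h1 : IsLocallyConstant fun p : AbsGal k kbar × AbsGal k kbar => χ p.1 :=
        χ.2.1.comp_continuous continuous_fst
      have h2 : IsLocallyConstant fun p : AbsGal k kbar × AbsGal k kbar => χ p.2 :=
        χ.2.1.comp_continuous continuous_snd
      have h3 : IsLocallyConstant fun p : AbsGal k kbar × AbsGal k kbar => χ (p.1 * p.2) :=
        χ.2.1.comp_continuous continuous_mul
      exact ((h1.prodMk h2).prodMk h3).comp fun t : (ZMod n × ZMod n) × ZMod n =>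
        toBarUnit kbar b ^ (((t.1.1.val : ℤ) + t.1.2.val - t.2.val) / n)
    · intro σ τ ρ
      simp only [smul_zpow', smul_toBarUnit, ← zpow_add]
      congr 1
      have hn : (n : ℤ) ≠ 0 := by exact_mod_cast NeZero.ne n
      apply mul_left_cancel₀ hn
      simp only [mul_add, mul_bockstein, mul_assoc]
      ring⟩

/-- The norm-residue symbol `⟨a, b⟩_n ∈ Br(k)` attached to the primitive `n`-th root of unity `ζ`:
the class of the cup product `b ∪ δχ_a`, where `χ_a` is the Kummer character of `a` with values
in `ℤ/n ≅ (1/n)ℤ/ℤ`. -/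
noncomputable def normResidue (kbar : Type*) [Field kbar] [Algebra k kbar] [IsAlgClosure k kbar]
    (hζ : IsPrimitiveRoot ζ n) (a b : UnitsModPow k n) : Br k kbar :=
  Additive.ofMul <| Quotient.liftOn' b
    (fun b => (QuotientGroup.mk (symbolCocycle (kummer kbar hζ a) b) :
      H2 (AbsGal k kbar) kbarˣ))
    fun b b' h => by
      obtain ⟨c, hc⟩ := QuotientGroup.leftRel_apply.mp h
      rw [QuotientGroup.eq]
      refine ⟨fun σ => toBarUnit kbar c ^ ((kummer kbar hζ a) σ).val,
        (kummer kbar hζ a).2.1.comp fun i => toBarUnit kbar c ^ i.val, fun σ τ => ?_⟩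
      change _ = (toBarUnit kbar b ^ bockstein (kummer kbar hζ a) (σ, τ))⁻¹ *
        toBarUnit kbar b' ^ bockstein (kummer kbar hζ a) (σ, τ)
      rw [← inv_zpow, ← mul_zpow, ← map_inv, ← map_mul, ← hc]
      rw [powMonoidHom_apply, map_pow, ← zpow_natCast, ← zpow_mul, mul_bockstein, smul_pow',
        smul_toBarUnit, zpow_sub, zpow_add]
      simp only [zpow_natCast]
      rw [div_mul_eq_mul_div, mul_comm, div_eq_mul_inv]

end NormResidue
end GaloisCohomology

namespace ThetaGroups

open CategoryTheory AlgebraicGeometry CartesianMonoidalCategory MonoidalCategory GaloisCohomology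
open scoped MonObj LaurentPolynomial

/-- The geometric point `Spec kbar`, as a scheme over `k`. -/
noncomputable abbrev geomPoint (k kbar : Type u) [Field k] [Field kbar] [Algebra k kbar] :
    Over (Spec (CommRingCat.of k)) :=
  (Spec (CommRingCat.of kbar)).asOver (Spec (CommRingCat.of k))

/-- The set `X(kbar)` of geometric points of a `k`-scheme `X`. It is a group if `X` is a group
scheme. -/
abbrev Pt {k : Type u} (kbar : Type u) [Field k] [Field kbar] [Algebra k kbar]
    (X : Over (Spec (CommRingCat.of k))) : Type u := geomPoint k kbar ⟶ X

/-- The multiplicative group `𝔾ₘ = Spec k[T, T⁻¹]` over `k`. -/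
noncomputable abbrev Gm (k : Type u) [Field k] : Over (Spec (CommRingCat.of k)) :=
  (Spec (CommRingCat.of k[T;T⁻¹])).asOver (Spec (CommRingCat.of k))

section Points

variable {k kbar : Type u} [Field k] [Field kbar] [Algebra k kbar]

/-- The automorphism of `Spec kbar` over `k` induced by a Galois automorphism. -/
noncomputable def specGal (σ : AbsGal k kbar) : geomPoint k kbar ⟶ geomPoint k kbar :=
  (Spec.map (CommRingCat.ofHom (σ : kbar →ₐ[k] kbar).toRingHom)).asOver _

theorem specGal_left (σ : AbsGal k kbar) :
    (specGal σ).left = Spec.map (CommRingCat.ofHom (σ : kbar →ₐ[k] kbar).toRingHom) := rfl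

theorem specGal_one : specGal (1 : AbsGal k kbar) = 𝟙 _ := by
  ext1
  rw [specGal_left]
  exact Spec.map_id _

theorem specGal_mul (σ τ : AbsGal k kbar) : specGal (σ * τ) = specGal σ ≫ specGal τ := by
  ext1
  exact Spec.map_comp (CommRingCat.ofHom (τ : kbar →ₐ[k] kbar).toRingHom)
    (CommRingCat.ofHom (σ : kbar →ₐ[k] kbar).toRingHom)

/-- The Galois action on the geometric points of a group scheme. -/
noncomputable instance (X : Over (Spec (CommRingCat.of k))) [GrpObj X] :
    MulDistribMulAction (AbsGal k kbar) (Pt kbar X) where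
  smul σ p := specGal σ ≫ p
  one_smul p := (congrArg (· ≫ p) specGal_one).trans (Category.id_comp p)
  mul_smul σ τ p := (congrArg (· ≫ p) (specGal_mul σ τ)).trans (Category.assoc _ _ _)
  smul_mul _ _ _ := MonObj.comp_mul _ _ _
  smul_one _ := MonObj.comp_one _

theorem smul_pt_def {X : Over (Spec (CommRingCat.of k))} [GrpObj X] (σ : AbsGal k kbar)
    (p : Pt kbar X) : σ • p = specGal σ ≫ p := rfl

/-- The homomorphism on geometric points induced by a homomorphism of group schemes. -/
noncomputable def ptMap (kbar : Type u) [Field kbar] [Algebra k kbar]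
    {X Y : Over (Spec (CommRingCat.of k))} [GrpObj X] [GrpObj Y]
    (f : X ⟶ Y) [IsMonHom f] : Pt kbar X →* Pt kbar Y where
  toFun p := p ≫ f
  map_one' := MonObj.one_comp f
  map_mul' p q := MonObj.mul_comp p q f

theorem ptMap_smul {X Y : Over (Spec (CommRingCat.of k))} [GrpObj X] [GrpObj Y]
    (f : X ⟶ Y) [IsMonHom f] (σ : AbsGal k kbar) (p : Pt kbar X) :
    ptMap kbar f (σ • p) = σ • ptMap kbar f p :=
  Category.assoc (specGal σ) p f

/-- The `k`-algebra homomorphism `k[T, T⁻¹] → kbar` with `T ↦ u`. -/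
noncomputable def evalGm (k : Type u) {kbar : Type u} [Field k] [Field kbar] [Algebra k kbar]
    (u : kbarˣ) : k[T;T⁻¹] →ₐ[k] kbar :=
  { LaurentPolynomial.eval₂ (algebraMap k kbar) u with
    commutes' := LaurentPolynomial.eval₂_C (algebraMap k kbar) u }

theorem evalGm_T (u : kbarˣ) (m : ℤ) : evalGm k u (LaurentPolynomial.T m) = (u ^ m : kbarˣ) :=
  LaurentPolynomial.eval₂_T (algebraMap k kbar) u m

theorem algHom_ext_T {f g : k[T;T⁻¹] →ₐ[k] kbar}
    (h : f (LaurentPolynomial.T 1) = g (LaurentPolynomial.T 1)) : f = g := by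
  refine AddMonoidAlgebra.algHom_ext' (φ₁ := f) (φ₂ := g) (MonoidHom.ext_mint h) ?_
  exact AlgHom.ext fun r => (f.commutes r).trans (g.commutes r).symm

/-- The identification `kbarˣ ≅ 𝔾ₘ(kbar)`. -/
noncomputable def gmPt (k kbar : Type u) [Field k] [Field kbar] [Algebra k kbar] :
    kbarˣ ≃* Pt kbar (Gm k) :=
  MulEquiv.trans
  { toFun := fun u => WithConv.toConv (evalGm k u)
    invFun := fun f => ⟨f.ofConv (LaurentPolynomial.T 1), f.ofConv (LaurentPolynomial.T (-1)), by
        rw [← map_mul, ← LaurentPolynomial.T_add]; simp, by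
        rw [← map_mul, ← LaurentPolynomial.T_add]; simp⟩
    left_inv := fun u => Units.ext (by simp [evalGm_T])
    right_inv := fun f => WithConv.ofConv_injective (algHom_ext_T (by simp [evalGm_T]))
    map_mul' := fun u v => WithConv.ofConv_injective (algHom_ext_T (by
      change _ = (WithConv.toConv (evalGm k u) * WithConv.toConv (evalGm k v)) _
      rw [AlgHom.convMul_apply]
      simp [evalGm_T])) } Spec.mapMulEquiv

theorem gmPt_smul (σ : AbsGal k kbar) (u : kbarˣ) : gmPt k kbar (σ • u) = σ • gmPt k kbar u := by
  have h : evalGm k (σ • u) = (σ : kbar →ₐ[k] kbar).comp (evalGm k u) :=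
    algHom_ext_T (by simp [evalGm_T])
  ext1
  change Spec.map (CommRingCat.ofHom (evalGm k (σ • u)).toRingHom) =
    Spec.map (CommRingCat.ofHom (σ : kbar →ₐ[k] kbar).toRingHom) ≫
      Spec.map (CommRingCat.ofHom (evalGm k u).toRingHom)
  rw [h, ← Spec.map_comp]
  rfl

theorem isLocallyConstant_smul_pt [IsAlgClosure k kbar] (X : Over (Spec (CommRingCat.of k)))
    [GrpObj X] [LocallyOfFiniteType X.hom] (p : Pt kbar X) :
    IsLocallyConstant fun σ : AbsGal k kbar => σ • p := by
  obtain ⟨R, f, hf, hx, -⟩ := Scheme.exists_affine_mem_range_and_range_subset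
    (X := X.left) (x := p.left (IsLocalRing.closedPoint kbar)) (U := ⊤) trivial
  have hrange : Set.range p.left ⊆ Set.range f := by
    rintro _ ⟨y, rfl⟩
    rwa [show y = IsLocalRing.closedPoint kbar from
      Subsingleton.elim (α := PrimeSpectrum kbar) _ _]
  obtain ⟨φ, hφ⟩ := Spec.map_surjective (R := R) (S := CommRingCat.of kbar)
    (IsOpenImmersion.lift f p.left hrange)
  have hp : Spec.map φ ≫ f = p.left := by
    rw [hφ]
    exact IsOpenImmersion.lift_fac f p.left hrange
  obtain ⟨c, hc⟩ := Spec.map_surjective (f ≫ X.hom)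
  have hcφ : c ≫ φ = CommRingCat.ofHom (algebraMap k kbar) := by
    apply Spec.map_injective
    rw [Spec.map_comp, hc, ← Category.assoc, hp]
    exact Over.w p
  have hfin : c.hom.FiniteType := by
    rw [← HasRingHomProperty.Spec_iff (P := @LocallyOfFiniteType), hc]
    infer_instance
  let _ : Algebra k R := c.hom.toAlgebra
  obtain ⟨S, hS⟩ := hfin.out
  rw [IsLocallyConstant.iff_eventually_eq]
  intro σ
  have hev : ∀ᶠ τ : AbsGal k kbar in nhds σ, ∀ s ∈ S, τ (φ.hom s) = σ (φ.hom s) := by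
    rw [Filter.eventually_all_finset]
    exact fun s _ => (isLocallyConstant_apply (k := k) (φ.hom s)).eventually_eq σ
  filter_upwards [hev] with τ hτ
  let φ' : R →ₐ[k] kbar := { φ.hom with
    commutes' := fun r => congr($hcφ r) }
  have hστ : (τ : kbar →ₐ[k] kbar).comp φ' = (σ : kbar →ₐ[k] kbar).comp φ' :=
    AlgHom.ext_of_adjoin_eq_top hS hτ
  ext1
  change Spec.map (CommRingCat.ofHom (τ : kbar →ₐ[k] kbar).toRingHom) ≫ p.left =
    Spec.map (CommRingCat.ofHom (σ : kbar →ₐ[k] kbar).toRingHom) ≫ p.left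
  rw [← hp, ← Category.assoc, ← Category.assoc, ← Spec.map_comp, ← Spec.map_comp]
  congr 2
  ext r
  exact congr($hστ r)

theorem ptMap_surjective [IsAlgClosure k kbar] {X Y : Over (Spec (CommRingCat.of k))}
    [GrpObj X] [GrpObj Y] (f : X ⟶ Y) [IsMonHom f] [LocallyOfFiniteType X.hom]
    [Surjective f.left] : Function.Surjective (ptMap kbar f) := by
  intro p
  have : IsAlgClosed kbar := IsAlgClosure.isAlgClosed k
  have : LocallyOfFiniteType (f.left ≫ Y.hom) := by rw [Over.w]; infer_instance
  have : LocallyOfFiniteType f.left := locallyOfFiniteType_of_comp f.left Y.hom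
  let q : Limits.pullback f.left p.left ⟶ Spec (CommRingCat.of kbar) :=
    Limits.pullback.snd f.left p.left
  have : LocallyOfFiniteType q := inferInstanceAs
    (LocallyOfFiniteType (Limits.pullback.snd f.left p.left))
  have : Surjective q := inferInstanceAs (Surjective (Limits.pullback.snd f.left p.left))
  have : JacobsonSpace ↥(Limits.pullback f.left p.left) := LocallyOfFiniteType.jacobsonSpace q
  obtain ⟨x, -⟩ := q.surjective (IsLocalRing.closedPoint kbar)
  obtain ⟨y, -, hy⟩ := nonempty_inter_closedPoints (Z := Set.univ) ⟨x, trivial⟩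
    isOpen_univ.isLocallyClosed
  let s := pointOfClosedPoint q y hy
  have hs : s ≫ q = 𝟙 _ := pointOfClosedPoint_comp q y hy
  have hcond : (s ≫ Limits.pullback.fst f.left p.left) ≫ f.left = p.left := by
    rw [Category.assoc, Limits.pullback.condition, ← Category.assoc]
    change (s ≫ q) ≫ p.left = _
    rw [hs]
    exact Category.id_comp _
  refine ⟨Over.homMk (s ≫ Limits.pullback.fst f.left p.left) ?_, ?_⟩
  · rw [← Over.w f, ← Category.assoc]
    exact (congrArg (· ≫ Y.hom) hcond).trans (Over.w p)
  · ext1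
    exact hcond

end Points

/-- The group `(ℤ/n)^g ⊕ (ℤ/n)^g`, written multiplicatively. -/
abbrev Coord (n g : ℕ) : Type := Multiplicative ((Fin g → ZMod n) × (Fin g → ZMod n))

/-- The `i`-th standard basis element of the first summand. -/
def coordX (n : ℕ) {g : ℕ} (i : Fin g) : Coord n g := Multiplicative.ofAdd (Pi.single i 1, 0)

/-- The `i`-th standard basis element of the second summand. -/
def coordY (n : ℕ) {g : ℕ} (i : Fin g) : Coord n g := Multiplicative.ofAdd (0, Pi.single i 1)

/-- An abstract theta group over the perfect field `k`: an algebraic group scheme `𝒢` over `k` in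
a short exact sequence `1 → 𝔾ₘ → 𝒢 → K → 1` such that the center of `𝒢` is `𝔾ₘ` and `K` is finite
étale, commutative, of order prime to the characteristic, with underlying abelian group of
the form `A ⊕ A`. Exactness means that `𝒢 → K` is faithfully flat with kernel `𝔾ₘ`. The underlying
abelian group of `K` and the center of `𝒢` are read off on points over an algebraic closure
(`𝒢` is smooth, being an extension of an étale group scheme by `𝔾ₘ`). -/
structure AbstractThetaGroup (k kbar : Type u) [Field k] [Field kbar] [Algebra k kbar] where
  /-- the group scheme `𝒢` -/
  G : Over (Spec (CommRingCat.of k))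
  /-- the quotient group scheme `K` -/
  K : Over (Spec (CommRingCat.of k))
  [grpG : GrpObj G]
  [grpK : CommGrpObj K]
  /-- the inclusion `𝔾ₘ → 𝒢` -/
  incl : Gm k ⟶ G
  /-- the projection `𝒢 → K` -/
  proj : G ⟶ K
  [isMonHom_incl : IsMonHom incl]
  [isMonHom_proj : IsMonHom proj]
  [locallyOfFiniteType_G : LocallyOfFiniteType G.hom]
  [quasiCompact_G : QuasiCompact G.hom]
  isPullback : IsPullback incl (toUnit (Gm k)) proj η[K]
  [flat_proj : Flat proj.left]
  [surjective_proj : Surjective proj.left]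
  center_eq : Subgroup.center (Pt kbar G) = (ptMap kbar incl).range
  [isFinite_K : IsFinite K.hom]
  [etale_K : Etale K.hom]
  exists_mulEquiv_prod : ∃ (A : Type) (_ : CommGroup A), Finite A ∧
    Nonempty (Pt kbar K ≃* A × A)
  card_ne_zero : (Nat.card (Pt kbar K) : k) ≠ 0

namespace AbstractThetaGroup

attribute [instance] grpG grpK isMonHom_incl isMonHom_proj locallyOfFiniteType_G quasiCompact_G
  flat_proj surjective_proj isFinite_K etale_K

variable {k kbar : Type u} [Field k] [Field kbar] [Algebra k kbar] [IsAlgClosure k kbar]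
  (T : AbstractThetaGroup k kbar)

/-- The central extension `1 → kbarˣ → 𝒢(kbar) → K(kbar) → 1` of discrete Galois groups. -/
noncomputable def centralExtension :
    CentralExtension (AbsGal k kbar) kbarˣ (Pt kbar T.G) (Pt kbar T.K) where
  incl := (ptMap kbar T.incl).comp (gmPt k kbar).toMonoidHom
  proj := ptMap kbar T.proj
  incl_injective := by
    refine fun u v h => (gmPt k kbar).injective ?_
    exact T.isPullback.hom_ext h (toUnit_unique _ _)
  proj_surjective := ptMap_surjective T.proj
  exact := by
    ext e
    constructor
    · rintro ⟨u, rfl⟩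
      change (gmPt k kbar u ≫ T.incl) ≫ T.proj = 1
      rw [Category.assoc, T.isPullback.w, ← Category.assoc]
      exact congrArg (· ≫ η[T.K]) (toUnit_unique _ _)
    · intro h
      have h' : e ≫ T.proj = toUnit _ ≫ η[T.K] := h
      refine ⟨(gmPt k kbar).symm (T.isPullback.lift e (toUnit _) h'), ?_⟩
      change gmPt k kbar ((gmPt k kbar).symm _) ≫ T.incl = e
      rw [MulEquiv.apply_symm_apply, IsPullback.lift_fst]
  central u e := by
    have : ptMap kbar T.incl (gmPt k kbar u) ∈ Subgroup.center (Pt kbar T.G) := by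
      rw [T.center_eq]
      exact ⟨_, rfl⟩
    exact (Subgroup.mem_center_iff.mp this e).symm
  incl_smul σ u := by
    change ptMap kbar T.incl (gmPt k kbar (σ • u)) = _
    rw [gmPt_smul, ptMap_smul]
    rfl
  proj_smul := ptMap_smul T.proj
  isLocallyConstant_smul := isLocallyConstant_smul_pt T.G

/-- The commutator pairing `e : K × K → 𝔾ₘ` on geometric points. -/
noncomputable def e (P R : Pt kbar T.K) : kbarˣ := T.centralExtension.commutatorPairing P R

/-- The obstruction map `Δ : H¹(k, K) → H²(k, 𝔾ₘ) = Br(k)`. -/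
noncomputable def obstruction (x : H1 (AbsGal k kbar) (Pt kbar T.K)) : Br k kbar :=
  Additive.ofMul (T.centralExtension.connecting x)

/-- `𝒢` is of type `(n, …, n)` (with `g` entries): the abelian group underlying `K` is `A ⊕ A`
with `A = (ℤ/n)^g`. -/
def IsOfType (n g : ℕ) : Prop :=
  Nonempty (Coord n g ≃* Pt kbar T.K)

/-- A Lagrangian structure: a decomposition `K = H ⊕ H*` of Galois modules into subgroups that are
isotropic for `e`. As `e` is nondegenerate, it identifies the second summand with the
Cartier dual of the first. -/
structure LagrangianStructure where
  /-- the first summand -/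
  H : Subgroup (Pt kbar T.K)
  /-- the second summand -/
  Hdual : Subgroup (Pt kbar T.K)
  smul_mem_H : ∀ (σ : AbsGal k kbar), ∀ P ∈ H, σ • P ∈ H
  smul_mem_Hdual : ∀ (σ : AbsGal k kbar), ∀ P ∈ Hdual, σ • P ∈ Hdual
  isCompl : IsCompl H Hdual
  isotropic_H : ∀ P ∈ H, ∀ R ∈ H, T.e P R = 1
  isotropic_Hdual : ∀ P ∈ Hdual, ∀ R ∈ Hdual, T.e P R = 1

/-- The subgroup `H` of `K(kbar)` is, as a Galois module, the constant module `(ℤ/n)^g`. -/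
def IsConstant (n g : ℕ) (H : Subgroup (Pt kbar T.K)) : Prop :=
  Nonempty (Multiplicative (Fin g → ZMod n) ≃* H) ∧
    ∀ (σ : AbsGal k kbar), ∀ P ∈ H, σ • P = P

/-- A `ζ`-symplectic basis `x₁, …, x_g, y₁, …, y_g` of the `ℤ/n`-module `K(kbar)`, given as the
isomorphism `(s, t) ↦ ∑ sᵢ xᵢ + ∑ tᵢ yᵢ` from `(ℤ/n)^g × (ℤ/n)^g` to `K(kbar)`. -/
structure SymplecticBasis (n g : ℕ) (ζ : k) where
  /-- the isomorphism that the basis defines -/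
  equiv : Coord n g ≃* Pt kbar T.K
  e_x_x : ∀ i j, T.e (equiv (coordX n i)) (equiv (coordX n j)) = 1
  e_y_y : ∀ i j, T.e (equiv (coordY n i)) (equiv (coordY n j)) = 1
  e_x_y : ∀ i j, (T.e (equiv (coordX n i)) (equiv (coordY n j)) : kbar) =
    if i = j then algebraMap k kbar ζ else 1

/-- The basis elements `xᵢ`. -/
noncomputable def SymplecticBasis.x {n g : ℕ} {ζ : k} {T : AbstractThetaGroup k kbar}
    (B : T.SymplecticBasis n g ζ) (i : Fin g) : Pt kbar T.K := B.equiv (coordX n i)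

/-- The basis elements `yᵢ`. -/
noncomputable def SymplecticBasis.y {n g : ℕ} {ζ : k} {T : AbstractThetaGroup k kbar}
    (B : T.SymplecticBasis n g ζ) (i : Fin g) : Pt kbar T.K := B.equiv (coordY n i)

end AbstractThetaGroup
end ThetaGroups

open GaloisCohomology ThetaGroups
open scoped CategoryTheory.MonObj

/-! Both summands of `K` are constant, so Galois acts trivially on `K(kbar)` and every value of `e`
lies in `k`. The pairing is bimultiplicative because commutators of lifts are central, and
nondegenerate because the center of `𝒢` is `𝔾ₘ` (`eq_one_of_pairing_eq_one`). For `x ∈ H` of order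
`n`, the values `e(x, ·)` on `H*` therefore form a cyclic group of order exactly `n`, and a
generator is a primitive `n`-th root of unity of `k` (`exists_isPrimitiveRoot`). For the same reason
`H*` is dual to `H`, and the basis of `H*` dual to a basis of `H` gives the symplectic basis
(`exists_symplectic_equiv`).

Over a trivial module `H¹` is a group of homomorphisms, and Kummer theory describes it by
coordinates in `kˣ/kˣⁿ` (`exists_H1_equiv`).

For `Δ`, the spans of the `xᵢ` and of the `yᵢ` are isotropic, and `kbarˣ` is divisible, so they lift
to homomorphisms `F` and `G` into `𝒢(kbar)` (`exists_hom_lift`). Galois moves these lifts only by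
scalars, that is, by characters `uᵢ` and `vᵢ` (`exists_characters`). With coordinate characters `s`,
`t` of the class, the cochain `N_σ = F(s(σ)) G(t(σ))` has an explicit coboundary: the scalars
contribute `∑ (uᵢ ∪ sᵢ + vᵢ ∪ tᵢ)`, and reordering `F` and `G` contributes `-∑ tᵢ ∪ sᵢ`
(`exists_connecting_eq`). Since `⟨a, b⟩ = -χ_b ∪ χ_a` (`normResidue_eq_neg_cup`), the last sum is `∑
⟨aᵢ, bᵢ⟩`. The Kummer classes of `vᵢ` and the inverses of those of `uᵢ` are the constants `C₁` and
`C₂`; bilinearity of the symbol then completes the linear terms to a shift. -/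

namespace GaloisCohomology

/-! ### Powers with exponents in `ℤ/n`, and roots of unity of `k` -/

section PowZMod

variable {n : ℕ} {M : Type*} [Monoid M] {z : M}

theorem pow_zmod_val_add [NeZero n] (hz : z ^ n = 1) (i j : ZMod n) :
    z ^ (i + j).val = z ^ i.val * z ^ j.val := by
  rw [ZMod.val_add, ← pow_add, ← pow_eq_pow_mod _ hz]

theorem pow_zmod_val_natCast (hz : z ^ n = 1) (i : ℕ) : z ^ (i : ZMod n).val = z ^ i := by
  rw [ZMod.val_natCast, ← pow_eq_pow_mod _ hz]

theorem pow_zmod_val_mul (hz : z ^ n = 1) (i j : ZMod n) :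
    z ^ (i * j).val = (z ^ i.val) ^ j.val := by
  rw [ZMod.val_mul, ← pow_mul, ← pow_eq_pow_mod _ hz]

theorem pow_zmod_val_neg [NeZero n] {G : Type*} [Group G] {z : G} (hz : z ^ n = 1) (i : ZMod n) :
    z ^ (-i).val = (z ^ i.val)⁻¹ := by
  rw [eq_inv_iff_mul_eq_one, ← pow_zmod_val_add hz, neg_add_cancel, ZMod.val_zero, pow_zero]

theorem _root_.IsPrimitiveRoot.pow_zmod_val_injective [NeZero n] {M : Type*} [CommMonoid M] {z : M}
    (hz : IsPrimitiveRoot z n) : Function.Injective fun i : ZMod n => z ^ i.val :=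
  fun i j h => ZMod.val_injective n (hz.pow_inj i.val_lt j.val_lt h)

/-- The homomorphism `i ↦ zⁱ` from `ℤ/n` for an element `z` with `zⁿ = 1`. -/
def powZMod [NeZero n] (hz : z ^ n = 1) : Multiplicative (ZMod n) →* M where
  toFun i := z ^ i.toAdd.val
  map_one' := by simp
  map_mul' i j := by rw [toAdd_mul, pow_zmod_val_add hz]

theorem powZMod_ofAdd [NeZero n] (hz : z ^ n = 1) (i : ZMod n) :
    powZMod hz (Multiplicative.ofAdd i) = z ^ i.val := rfl

end PowZMod

section RootUnit

variable {k : Type*} [Field k] {n : ℕ} [NeZero n] {ζ : k}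

/-- A primitive root of unity `ζ` of `k` as a unit of `kbar`. -/
noncomputable def rootUnit (kbar : Type*) [Field kbar] [Algebra k kbar]
    (hζ : IsPrimitiveRoot ζ n) : kbarˣ :=
  toBarUnit kbar (hζ.isUnit (NeZero.ne n)).unit

variable {kbar : Type*} [Field kbar] [Algebra k kbar] (hζ : IsPrimitiveRoot ζ n)

theorem val_rootUnit : (rootUnit kbar hζ : kbar) = algebraMap k kbar ζ := rfl

theorem isPrimitiveRoot_rootUnit : IsPrimitiveRoot (rootUnit kbar hζ) n :=
  IsPrimitiveRoot.coe_units_iff.mp (hζ.map_of_injective (algebraMap k kbar).injective)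

theorem rootUnit_pow : rootUnit kbar hζ ^ n = 1 := (isPrimitiveRoot_rootUnit hζ).pow_eq_one

theorem smul_rootUnit (σ : AbsGal k kbar) : σ • rootUnit kbar hζ = rootUnit kbar hζ :=
  smul_toBarUnit σ _

theorem smul_rootUnit_pow (σ : AbsGal k kbar) (m : ℕ) :
    σ • rootUnit kbar hζ ^ m = rootUnit kbar hζ ^ m := by
  rw [smul_pow', smul_rootUnit]

theorem exists_eq_rootUnit_pow {u : kbarˣ} (hu : u ^ n = 1) :
    ∃ i : ZMod n, u = rootUnit kbar hζ ^ i.val := by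
  obtain ⟨i, hi, h⟩ := (hζ.map_of_injective (algebraMap k kbar).injective).eq_pow_of_pow_eq_one
    (ξ := (u : kbar)) (by rw [← Units.val_pow_eq_pow_val, hu, Units.val_one])
  refine ⟨i, Units.ext ?_⟩
  rw [pow_zmod_val_natCast (rootUnit_pow hζ), Units.val_pow_eq_pow_val, val_rootUnit, h]

end RootUnit

/-! ### Kummer theory over a perfect field -/

section Kummer

variable {k kbar : Type*} [Field k] [Field kbar] [Algebra k kbar] [IsAlgClosure k kbar]
  {n : ℕ} [NeZero n] {ζ : k} (hζ : IsPrimitiveRoot ζ n)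

theorem isGalois_of_isAlgClosure (k kbar : Type*) [Field k] [Field kbar] [Algebra k kbar]
    [IsAlgClosure k kbar] [PerfectField k] : IsGalois k kbar := by
  have : Normal k kbar := IsAlgClosure.normal k kbar
  have : Algebra.IsAlgebraic k kbar := IsAlgClosure.isAlgebraic
  have : Algebra.IsSeparable k kbar := Algebra.IsAlgebraic.isSeparable_of_perfectField
  exact IsGalois.mk

theorem exists_pow_eq_unit (k : Type*) {kbar : Type*} [Field k] [Field kbar] [Algebra k kbar]
    [IsAlgClosure k kbar] (n : ℕ) [NeZero n] (u : kbarˣ) : ∃ v : kbarˣ, v ^ n = u := by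
  have : IsAlgClosed kbar := IsAlgClosure.isAlgClosed k
  obtain ⟨α, hα⟩ := IsAlgClosed.exists_pow_nat_eq (u : kbar) (NeZero.pos n)
  have h0 : α ≠ 0 := by
    rintro rfl
    rw [zero_pow (NeZero.ne n)] at hα
    exact u.ne_zero hα.symm
  exact ⟨Units.mk0 α h0, Units.ext hα⟩

/-- The Kummer character is determined by the Galois action on one `n`-th root. -/
theorem kummer_eq_iff (a : kˣ) {α : kbarˣ} (hα : α ^ n = toBarUnit kbar a) (σ : AbsGal k kbar)
    (i : ZMod n) :
    kummer kbar hζ (QuotientGroup.mk a) σ = i ↔ σ • α = rootUnit kbar hζ ^ i.val * α := by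
  have hα' : (α : kbar) ^ n = algebraMap k kbar a := congrArg Units.val hα
  have key : ∀ j : ZMod n, (σ • α = rootUnit kbar hζ ^ j.val * α ↔
      σ (α : kbar) = algebraMap k kbar ζ ^ j.val * α) := fun j => by
    rw [Units.ext_iff, Units.val_mul, Units.val_pow_eq_pow_val, val_rootUnit]
    rfl
  rw [key]
  change kummerFun hζ a σ = i ↔ _
  constructor
  · rintro rfl
    exact kummerFun_spec hζ a σ _ hα'
  · intro h
    rw [kummerFun_eq_of hζ a σ _ hα' _ h, ZMod.natCast_zmod_val]

theorem kummer_mul (a b : UnitsModPow k n) (σ : AbsGal k kbar) :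
    kummer kbar hζ (a * b) σ = kummer kbar hζ a σ + kummer kbar hζ b σ := by
  induction a using QuotientGroup.induction_on with | H a =>
  induction b using QuotientGroup.induction_on with | H b =>
  obtain ⟨α, hα⟩ := exists_pow_eq_unit k n (toBarUnit kbar a)
  obtain ⟨β, hβ⟩ := exists_pow_eq_unit k n (toBarUnit kbar b)
  rw [← QuotientGroup.mk_mul, kummer_eq_iff hζ (a * b) (α := α * β) (by rw [mul_pow, hα, hβ, map_mul]),
    smul_mul', (kummer_eq_iff hζ a hα σ _).mp rfl, (kummer_eq_iff hζ b hβ σ _).mp rfl,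
    pow_zmod_val_add (rootUnit_pow hζ), mul_mul_mul_comm]

theorem kummer_one (σ : AbsGal k kbar) : kummer kbar hζ 1 σ = 0 := by
  have h : (1 : UnitsModPow k n) * 1 = 1 := mul_one (M := UnitsModPow k n) 1
  simpa only [h, left_eq_add] using kummer_mul hζ (kbar := kbar) 1 1 σ

theorem kummer_inv (a : UnitsModPow k n) (σ : AbsGal k kbar) :
    kummer kbar hζ a⁻¹ σ = -kummer kbar hζ a σ := by
  have h : a⁻¹ * a = 1 := inv_mul_cancel a
  rw [eq_neg_iff_add_eq_zero, ← kummer_mul, h, kummer_one]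

/-- Perfectness makes `kbar/k` Galois, so that Galois-fixed units descend to `k`. -/
theorem mem_range_toBarUnit {k kbar : Type*} [Field k] [Field kbar] [Algebra k kbar]
    [IsAlgClosure k kbar] [PerfectField k] {u : kbarˣ} (h : ∀ σ : AbsGal k kbar, σ • u = u) :
    ∃ a : kˣ, toBarUnit kbar a = u := by
  have := isGalois_of_isAlgClosure k kbar
  have hu : (u : kbar) ∈ (⊥ : IntermediateField k kbar) :=
    (InfiniteGalois.mem_bot_iff_fixed _).mpr fun σ => congrArg Units.val (h σ)
  obtain ⟨a, ha⟩ := IntermediateField.mem_bot.mp hu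
  have h0 : a ≠ 0 := by
    rintro rfl
    exact u.ne_zero (by rw [← ha, map_zero])
  exact ⟨Units.mk0 a h0, Units.ext ha⟩

/-- If the character vanishes, an `n`-th root of `a` is fixed by Galois and hence lies in `k`. -/
theorem eq_one_of_kummer_eq_zero [PerfectField k] {a : UnitsModPow k n}
    (h : ∀ σ, kummer kbar hζ a σ = 0) : a = 1 := by
  induction a using QuotientGroup.induction_on with | H a =>
  obtain ⟨α, hα⟩ := exists_pow_eq_unit k n (toBarUnit kbar a)
  obtain ⟨c, rfl⟩ := mem_range_toBarUnit (k := k) (u := α) fun σ => by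
    rw [(kummer_eq_iff hζ a hα σ 0).mp (h σ), ZMod.val_zero, pow_zero, one_mul]
  rw [QuotientGroup.eq_one_iff]
  refine ⟨c, Units.ext ((algebraMap k kbar).injective ?_)⟩
  rw [← map_pow] at hα
  exact congrArg Units.val hα

theorem kummer_injective [PerfectField k] {a b : UnitsModPow k n}
    (h : ∀ σ, kummer kbar hζ a σ = kummer kbar hζ b σ) : a = b := by
  refine mul_inv_eq_one.mp ?_
  refine eq_one_of_kummer_eq_zero (kbar := kbar) hζ fun σ => ?_
  rw [kummer_mul, kummer_inv, h, add_neg_cancel]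

/-- Hilbert's theorem 90 for characters with values in the roots of unity of `k`. -/
theorem exists_smul_eq_rootUnit_pow [PerfectField k] (χ : Character (AbsGal k kbar) n) :
    ∃ α : kbarˣ, ∀ σ : AbsGal k kbar, σ • α = rootUnit kbar hζ ^ (χ σ).val * α := by
  have := isGalois_of_isAlgClosure k kbar
  have h1 : χ 1 = 0 := by
    have := χ.2.2 1 1
    rwa [mul_one, left_eq_add] at this
  have hnhds : {σ : AbsGal k kbar | χ σ = 0} ∈ nhds 1 := by
    filter_upwards [χ.2.1.eventually_eq 1] with σ hσ
    exact hσ.trans h1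
  -- Local constancy makes `χ` factor through the Galois group of a finite normal `F/k`, which
  -- reduces the claim to Hilbert 90 for a finite extension.
  obtain ⟨F, hF, hFn, hFχ⟩ := (krullTopology_mem_nhds_one_iff_of_normal k kbar _).mp hnhds
  have hsurj := AlgEquiv.restrictNormalHom_surjective (F := k) (K₁ := F) kbar
  choose l hl using hsurj
  -- `χ (l s)` does not depend on the extension `l s` of `s` to `kbar`, so `χ` descends although `l`
  -- is not a homomorphism.
  have hχ : ∀ σ τ : AbsGal k kbar, AlgEquiv.restrictNormalHom F σ = AlgEquiv.restrictNormalHom F τ →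
      χ σ = χ τ := fun σ τ h => by
    have hm : τ⁻¹ * σ ∈ F.fixingSubgroup := by
      rw [← IntermediateField.restrictNormalHom_ker, MonoidHom.mem_ker, map_mul, map_inv, h,
        inv_mul_cancel]
    have h0 : χ (τ⁻¹ * σ) = 0 := hFχ hm
    have := χ.2.2 τ (τ⁻¹ * σ)
    rwa [mul_inv_cancel_left, h0, add_zero] at this
  obtain ⟨β, hβ⟩ := groupCohomology.isMulCoboundary₁_of_isMulCocycle₁_of_aut_to_units
    (fun s : F ≃ₐ[k] F => rootUnit F hζ ^ (χ (l s)).val) fun s t => by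
      beta_reduce
      rw [smul_rootUnit_pow, hχ (l (s * t)) (l s * l t) (by rw [map_mul, hl, hl, hl]), χ.2.2,
        pow_zmod_val_add (rootUnit_pow hζ), mul_comm]
  refine ⟨Units.map (algebraMap F kbar).toMonoidHom β, fun σ => Units.ext ?_⟩
  have h := hβ (AlgEquiv.restrictNormalHom F σ)
  beta_reduce at h
  rw [hχ _ σ (hl _), div_eq_iff_eq_mul] at h
  have h' := congrArg (fun u : Fˣ => algebraMap F kbar u) h
  refine Eq.trans ?_ h'
  exact (AlgEquiv.restrictNormal_commutes σ F β).symm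

/-- Hilbert 90 gives `α` on which Galois acts through `ζ^χ`; then `αⁿ` is fixed, and it is the
required `a`. -/
theorem exists_kummer_eq [PerfectField k] (χ : Character (AbsGal k kbar) n) :
    ∃ a : UnitsModPow k n, ∀ σ, kummer kbar hζ a σ = χ σ := by
  obtain ⟨α, hα⟩ := exists_smul_eq_rootUnit_pow hζ χ
  obtain ⟨a, ha⟩ := mem_range_toBarUnit (k := k) (u := α ^ n) fun σ => by
    rw [smul_pow', hα, mul_pow, ← pow_mul, mul_comm _ n, pow_mul, rootUnit_pow, one_pow, one_mul]
  exact ⟨QuotientGroup.mk a, fun σ => (kummer_eq_iff hζ a ha.symm σ _).mpr (hα σ)⟩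

end Kummer

/-! ### Cup products of characters and the norm-residue symbol -/

section Cup

variable {k kbar : Type*} [Field k] [Field kbar] [Algebra k kbar]
  {n : ℕ} [NeZero n] {ζ : k} (hζ : IsPrimitiveRoot ζ n)

/-- The two-cocycle `(σ, τ) ↦ ζ ^ (χ(σ) ψ(τ))`. -/
noncomputable def cupCocycle (χ ψ : Character (AbsGal k kbar) n) : Z2 (AbsGal k kbar) kbarˣ :=
  ⟨fun p => rootUnit kbar hζ ^ (χ p.1 * ψ p.2).val, by
    constructor
    · have h1 : IsLocallyConstant fun p : AbsGal k kbar × AbsGal k kbar => χ p.1 :=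
        χ.2.1.comp_continuous continuous_fst
      have h2 : IsLocallyConstant fun p : AbsGal k kbar × AbsGal k kbar => ψ p.2 :=
        ψ.2.1.comp_continuous continuous_snd
      exact (h1.prodMk h2).comp fun t => rootUnit kbar hζ ^ (t.1 * t.2).val
    · intro σ τ ρ
      simp only [smul_rootUnit_pow, χ.2.2, ψ.2.2, ← pow_zmod_val_add (rootUnit_pow hζ)]
      congr 2
      ring⟩

/-- The class of the cup product of two characters in `Br(k)`. -/
noncomputable def cup (χ ψ : Character (AbsGal k kbar) n) : Br k kbar :=
  Additive.ofMul (QuotientGroup.mk (cupCocycle hζ χ ψ))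

theorem cup_add_left {χ χ' χ'' : Character (AbsGal k kbar) n} (h : ∀ σ, χ σ = χ' σ + χ'' σ)
    (ψ : Character (AbsGal k kbar) n) : cup hζ χ ψ = cup hζ χ' ψ + cup hζ χ'' ψ := by
  have : cupCocycle hζ χ ψ = cupCocycle hζ χ' ψ * cupCocycle hζ χ'' ψ :=
    Subtype.ext (funext fun p => by
      change rootUnit kbar hζ ^ _ = rootUnit kbar hζ ^ _ * rootUnit kbar hζ ^ _
      rw [h, add_mul, pow_zmod_val_add (rootUnit_pow hζ)])
  rw [cup, this]
  rfl

theorem cup_antisymm (χ ψ : Character (AbsGal k kbar) n) : cup hζ χ ψ = -cup hζ ψ χ := by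
  have hz := rootUnit_pow hζ (kbar := kbar)
  refine Eq.symm (congrArg Additive.ofMul (?_ :
    (QuotientGroup.mk (cupCocycle hζ ψ χ)⁻¹ : H2 (AbsGal k kbar) kbarˣ) = QuotientGroup.mk _))
  rw [QuotientGroup.eq, inv_inv]
  -- Expanding `(χ(σ) + χ(τ)) (ψ(σ) + ψ(τ))` shows that the coboundary of `-χψ` is the sum of the
  -- two mixed terms.
  refine ⟨fun σ => rootUnit kbar hζ ^ (-(χ σ * ψ σ)).val,
    (χ.2.1.prodMk ψ.2.1).comp fun t => rootUnit kbar hζ ^ (-(t.1 * t.2)).val, fun σ τ => ?_⟩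
  change _ = rootUnit kbar hζ ^ (ψ σ * χ τ).val * rootUnit kbar hζ ^ (χ σ * ψ τ).val
  rw [smul_rootUnit_pow, div_eq_mul_inv, ← pow_zmod_val_neg hz, ← pow_zmod_val_add hz,
    ← pow_zmod_val_add hz, ← pow_zmod_val_add hz, χ.2.2, ψ.2.2]
  congr 2
  ring

variable [IsAlgClosure k kbar]

/-- The norm-residue symbol `b ∪ δχ_a` is the opposite of `χ_b ∪ χ_a`. -/
theorem normResidue_eq_neg_cup (a b : UnitsModPow k n) :
    normResidue kbar hζ a b = -cup hζ (kummer kbar hζ b) (kummer kbar hζ a) := by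
  induction b using QuotientGroup.induction_on with | H b =>
  obtain ⟨β, hβ⟩ := exists_pow_eq_unit k n (toBarUnit kbar b)
  set χ := kummer kbar hζ a
  set ψ := kummer kbar hζ (b : UnitsModPow k n)
  refine Eq.symm (congrArg Additive.ofMul (?_ :
    (QuotientGroup.mk (cupCocycle hζ ψ χ)⁻¹ : H2 (AbsGal k kbar) kbarˣ) =
      QuotientGroup.mk (symbolCocycle χ b)))
  rw [QuotientGroup.eq, inv_inv]
  -- In the coboundary of `σ ↦ β^χ(σ)` with `βⁿ = b`, the action on `β` gives `ζ^(ψ(σ) χ(τ))`. The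
  -- carry `χ(σ) + χ(τ) - χ(στ)` of the integer representatives is `n` times the Bockstein cocycle
  -- and gives the power of `b`.
  refine ⟨fun σ => β ^ (χ σ).val, χ.2.1.comp fun i => β ^ i.val, fun σ τ => ?_⟩
  change _ = rootUnit kbar hζ ^ (ψ σ * χ τ).val * toBarUnit kbar b ^ bockstein χ (σ, τ)
  rw [smul_pow', (kummer_eq_iff hζ b hβ σ (ψ σ)).mp rfl, ← hβ, mul_pow,
    ← pow_zmod_val_mul (rootUnit_pow hζ), ← zpow_natCast β n, ← zpow_mul, mul_bockstein, zpow_sub,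
    zpow_add]
  simp only [zpow_natCast, div_eq_mul_inv]
  simp only [mul_assoc, mul_comm, mul_left_comm]

theorem normResidue_swap (a b : UnitsModPow k n) :
    normResidue kbar hζ a b = -normResidue kbar hζ b a := by
  rw [normResidue_eq_neg_cup, normResidue_eq_neg_cup, cup_antisymm]

theorem normResidue_mul_right (a b b' : UnitsModPow k n) :
    normResidue kbar hζ a (b * b') = normResidue kbar hζ a b + normResidue kbar hζ a b' := by
  simp only [normResidue_eq_neg_cup]
  rw [cup_add_left hζ (kummer_mul hζ b b')]
  exact neg_add (α := Br k kbar) _ _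

theorem normResidue_mul_left (a a' b : UnitsModPow k n) :
    normResidue kbar hζ (a * a') b = normResidue kbar hζ a b + normResidue kbar hζ a' b := by
  rw [normResidue_swap hζ, normResidue_mul_right, normResidue_swap hζ a, normResidue_swap hζ a']
  exact neg_add (α := Br k kbar) _ _

theorem normResidue_inv_right (a b : UnitsModPow k n) :
    normResidue kbar hζ a b⁻¹ = -normResidue kbar hζ a b := by
  let f : UnitsModPow k n →* H2 (AbsGal k kbar) kbarˣ := MonoidHom.mk'
    (fun b => (normResidue kbar hζ a b).toMul) (normResidue_mul_right hζ a)
  exact map_inv f b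

end Cup

end GaloisCohomology

namespace GaloisCohomology.CentralExtension

/-! ### The commutator pairing of a central extension and its nondegeneracy -/

section Pairing

variable {Γ C E Q : Type*} [Group Γ] [TopologicalSpace Γ]
  [CommGroup C] [Group E] [CommGroup Q] [MulDistribMulAction Γ C] [MulDistribMulAction Γ E]
  [MulDistribMulAction Γ Q] (X : CentralExtension Γ C E Q)

/-- The commutator of lifts of `P'` and `R` is central, so it can be pulled out of the commutator
with the product of lifts. -/
theorem commutatorPairing_mul_left (P P' R : Q) : X.commutatorPairing (P * P') R =
    X.commutatorPairing P R * X.commutatorPairing P' R := by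
  obtain ⟨a, rfl⟩ := X.proj_surjective P
  obtain ⟨a', rfl⟩ := X.proj_surjective P'
  obtain ⟨b, rfl⟩ := X.proj_surjective R
  apply X.incl_injective
  have h := X.incl_commutatorPairing a' b
  have hc := X.central (X.commutatorPairing (X.proj a') (X.proj b)) (a * b * a⁻¹ * b⁻¹)
  rw [← map_mul X.proj, map_mul X.incl, X.incl_commutatorPairing, X.incl_commutatorPairing,
    ← hc, ← mul_assoc, ← mul_assoc, ← mul_assoc, X.central, h]
  group

theorem commutatorPairing_swap (P R : Q) :
    X.commutatorPairing R P = (X.commutatorPairing P R)⁻¹ := by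
  obtain ⟨a, rfl⟩ := X.proj_surjective P
  obtain ⟨b, rfl⟩ := X.proj_surjective R
  apply X.incl_injective
  rw [map_inv, X.incl_commutatorPairing, X.incl_commutatorPairing]
  group

theorem commutatorPairing_mul_right (P R R' : Q) : X.commutatorPairing P (R * R') =
    X.commutatorPairing P R * X.commutatorPairing P R' := by
  rw [X.commutatorPairing_swap, X.commutatorPairing_mul_left, mul_inv, ← X.commutatorPairing_swap,
    ← X.commutatorPairing_swap]

/-- The commutator pairing as a bimultiplicative map. -/
noncomputable def pairing : Q →* Q →* C :=
  MonoidHom.mk' (fun P => MonoidHom.mk' (X.commutatorPairing P) (X.commutatorPairing_mul_right P))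
    fun P P' => MonoidHom.ext (X.commutatorPairing_mul_left P P')

theorem pairing_proj (a b : E) : X.incl (X.pairing (X.proj a) (X.proj b)) = a * b * a⁻¹ * b⁻¹ :=
  X.incl_commutatorPairing a b

theorem pairing_swap (P R : Q) : X.pairing R P = (X.pairing P R)⁻¹ :=
  X.commutatorPairing_swap P R

theorem smul_pairing (σ : Γ) (P R : Q) : σ • X.pairing P R = X.pairing (σ • P) (σ • R) := by
  obtain ⟨a, rfl⟩ := X.proj_surjective P
  obtain ⟨b, rfl⟩ := X.proj_surjective R
  apply X.incl_injective
  rw [X.incl_smul, ← X.proj_smul, ← X.proj_smul, X.pairing_proj, X.pairing_proj]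
  simp only [smul_mul', smul_inv']

theorem commute_of_pairing_eq_one {a b : E} (h : X.pairing (X.proj a) (X.proj b) = 1) :
    Commute a b := by
  have := X.pairing_proj a b
  rw [h, map_one, eq_comm, mul_inv_eq_one, mul_inv_eq_iff_eq_mul] at this
  exact this

/-- A lift of an element of the radical commutes with all of `E`; it is then central, hence in `C`,
and projects to `1`. -/
theorem eq_one_of_pairing_eq_one (hX : Subgroup.center E ≤ X.incl.range) {P : Q}
    (h : ∀ R, X.pairing P R = 1) : P = 1 := by
  obtain ⟨a, rfl⟩ := X.proj_surjective P
  obtain ⟨c, rfl⟩ := hX (Subgroup.mem_center_iff.mpr fun b =>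
    (X.commute_of_pairing_eq_one (h (X.proj b))).symm)
  exact X.proj_incl c

/-- Since `H` is isotropic, an element of `H` orthogonal to `H'` is orthogonal to everything. This
is the duality between two complementary isotropic subgroups. -/
theorem eq_one_of_mem_left {H H' : Subgroup Q} (hX : Subgroup.center E ≤ X.incl.range)
    (hc : Codisjoint H H') (hH : ∀ P ∈ H, ∀ R ∈ H, X.pairing P R = 1) {P : Q} (hP : P ∈ H)
    (h : ∀ R ∈ H', X.pairing P R = 1) : P = 1 := by
  refine X.eq_one_of_pairing_eq_one hX fun R => ?_
  obtain ⟨R₁, h₁, R₂, h₂, rfl⟩ := Subgroup.mem_sup.mp (hc.eq_top.ge (Subgroup.mem_top R))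
  rw [map_mul, hH P hP R₁ h₁, h R₂ h₂, one_mul]

/-- This frees the connecting map from the arbitrary section `lift`: any locally constant lift of
the cocycle computes it. -/
theorem connecting_eq_of_isBoundaryOf [IsTopologicalGroup Γ] {c : Z2 Γ C} {N : Γ → E}
    (hN : IsLocallyConstant N) (h : X.IsBoundaryOf c N) (ξ : Z1 Γ Q)
    (hξ : ∀ σ, X.proj (N σ) = ξ.1 σ) :
    X.connecting (QuotientGroup.mk ξ) = QuotientGroup.mk c := by
  refine X.mk_eq_of_isBoundaryOf (ξ.2.1.comp X.lift) hN (X.isBoundaryOf_connectingCocycle ξ) h 1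
    fun σ => ?_
  simp only [Function.comp_apply, X.proj_lift, hξ, smul_one, div_one, one_mul]

end Pairing

/-! ### Generators and coordinates of `(ℤ/n)^g` -/

section Finite

variable {n g : ℕ}

/-- The `i`-th standard generator of `(ℤ/n)^g`. -/
def stdGen (n : ℕ) {g : ℕ} (i : Fin g) : Fin g → Multiplicative (ZMod n) :=
  Pi.mulSingle i (Multiplicative.ofAdd 1)

theorem stdGen_pow (i : Fin g) : stdGen n i ^ n = 1 := by
  rw [stdGen, ← Pi.mulSingle_pow, ← ofAdd_nsmul]
  simp

theorem map_eq_prod_stdGen [NeZero n] {A : Type*} [CommMonoid A]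
    (f : (Fin g → Multiplicative (ZMod n)) →* A) (s : Fin g → Multiplicative (ZMod n)) :
    f s = ∏ i, f (stdGen n i) ^ (s i).toAdd.val := by
  conv_lhs => rw [← Finset.univ_prod_mulSingle s, map_prod]
  refine Finset.prod_congr rfl fun i _ => ?_
  rw [← map_pow, stdGen, ← Pi.mulSingle_pow, ← ofAdd_nsmul]
  simp

theorem hom_ext_stdGen [NeZero n] {A : Type*} [CommMonoid A]
    {f f' : (Fin g → Multiplicative (ZMod n)) →* A} (h : ∀ i, f (stdGen n i) = f' (stdGen n i)) :
    f = f' :=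
  MonoidHom.ext fun s => by rw [map_eq_prod_stdGen f, map_eq_prod_stdGen f']; simp only [h]

/-- The inclusion of the first summand of `(ℤ/n)^g ⊕ (ℤ/n)^g`. -/
def coordInl (n g : ℕ) : (Fin g → Multiplicative (ZMod n)) →* Coord n g where
  toFun s := Multiplicative.ofAdd (fun i => (s i).toAdd, 0)
  map_one' := rfl
  map_mul' s t := by rw [← ofAdd_add, Prod.mk_add_mk, add_zero]; rfl

/-- The inclusion of the second summand of `(ℤ/n)^g ⊕ (ℤ/n)^g`. -/
def coordInr (n g : ℕ) : (Fin g → Multiplicative (ZMod n)) →* Coord n g where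
  toFun s := Multiplicative.ofAdd (0, fun i => (s i).toAdd)
  map_one' := rfl
  map_mul' s t := by rw [← ofAdd_add, Prod.mk_add_mk, add_zero]; rfl

theorem coordInl_stdGen (i : Fin g) : coordInl n g (stdGen n i) = coordX n i := by
  refine congrArg (fun v => Multiplicative.ofAdd (v, 0)) (funext fun j => ?_)
  by_cases h : j = i
  · subst h; simp [stdGen]
  · simp [stdGen, h]

theorem coordInr_stdGen (i : Fin g) : coordInr n g (stdGen n i) = coordY n i := by
  refine congrArg (fun v => Multiplicative.ofAdd (0, v)) (funext fun j => ?_)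
  by_cases h : j = i
  · subst h; simp [stdGen]
  · simp [stdGen, h]

theorem coordInl_mul_coordInr (s t : Fin g → ZMod n) :
    coordInl n g (fun i => Multiplicative.ofAdd (s i)) *
      coordInr n g (fun i => Multiplicative.ofAdd (t i)) = Multiplicative.ofAdd (s, t) := by
  change Multiplicative.ofAdd ((s, 0) + (0, t)) = _
  rw [Prod.mk_add_mk, add_zero, zero_add]

theorem coord_pow (q : Coord n g) : q ^ n = 1 := by
  rw [← ofAdd_toAdd q, ← ofAdd_nsmul]
  refine congrArg Multiplicative.ofAdd (Prod.ext (funext fun i => ?_) (funext fun i => ?_)) <;> simp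

end Finite

/-! ### Central extensions of Galois modules by `kbarˣ` -/

section Galois

variable {k kbar E Q : Type*} [Field k] [Field kbar] [Algebra k kbar] [Group E] [CommGroup Q] [MulDistribMulAction (AbsGal k kbar) E]
  [MulDistribMulAction (AbsGal k kbar) Q] (X : CentralExtension (AbsGal k kbar) kbarˣ E Q)
  {n g : ℕ}

/-- The image of `e(x, ·)` on `H'` is a finite subgroup of `kbarˣ`, hence cyclic. Its order is that
of `x` by nondegeneracy, and its generator is fixed by Galois because `x` and `y` are. -/
theorem exists_isPrimitiveRoot [IsAlgClosure k kbar] [PerfectField k] [Finite Q]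
    (hX : Subgroup.center E ≤ X.incl.range) (htriv : ∀ (σ : AbsGal k kbar) (P : Q), σ • P = P)
    {H H' : Subgroup Q} (hc : Codisjoint H H') (hH : ∀ P ∈ H, ∀ R ∈ H, X.pairing P R = 1)
    {x : Q} (hx : x ∈ H) (hn : orderOf x = n) : ∃ ζ : k, IsPrimitiveRoot ζ n := by
  let f : H' →* kbarˣ := (X.pairing x).comp H'.subtype
  have : Finite f.range := Finite.of_surjective _ f.rangeRestrict_surjective
  obtain ⟨⟨_, y, rfl⟩, hy⟩ := IsCyclic.exists_generator (α := f.range)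
  have hord : orderOf (f y) = n := by
    refine Nat.dvd_antisymm (orderOf_dvd_of_pow_eq_one ?_) ?_
    · change X.pairing x y ^ n = 1
      rw [← MonoidHom.pow_apply, ← map_pow, ← hn, pow_orderOf_eq_one, map_one, MonoidHom.one_apply]
    -- If `m` is the order of the generator, every `e(x, R)^m = e(x^m, R)` with `R ∈ H'` is trivial,
    -- which forces `x^m = 1`.
    · rw [← hn]
      refine orderOf_dvd_of_pow_eq_one
        (X.eq_one_of_mem_left hX hc hH (H.pow_mem hx _) fun R hR => ?_)
      obtain ⟨m, hm⟩ := Subgroup.mem_zpowers_iff.mp (hy ⟨f ⟨R, hR⟩, ⟨R, hR⟩, rfl⟩)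
      have hm' : f y ^ m = X.pairing x R := congrArg Subtype.val hm
      rw [map_pow, MonoidHom.pow_apply, ← hm', ← zpow_natCast, ← zpow_mul, mul_comm, zpow_mul,
        zpow_natCast, pow_orderOf_eq_one, one_zpow]
  obtain ⟨a, ha⟩ := mem_range_toBarUnit (k := k) (u := f y) fun σ => by
    change σ • X.pairing x y = X.pairing x y
    rw [X.smul_pairing, htriv, htriv]
  refine ⟨a, IsPrimitiveRoot.of_map_of_injective (f := algebraMap k kbar) ?_
    (algebraMap k kbar).injective⟩
  have := IsPrimitiveRoot.orderOf (f y)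
  rw [hord, ← IsPrimitiveRoot.coe_units_iff, ← ha] at this
  exact this

variable [NeZero n] {ζ : k} (hζ : IsPrimitiveRoot ζ n)

/-- A basis `xᵢ` of `H` is transported from `φ`, and the `yⱼ` are its dual basis in `H'` for the
pairing. The isomorphism `ψ` serves only to count `H'`. -/
theorem exists_symplectic_equiv (hX : Subgroup.center E ≤ X.incl.range)
    {H H' : Subgroup Q} (hc : IsCompl H H')
    (hH' : ∀ P ∈ H', ∀ R ∈ H', X.pairing P R = 1)
    (φ : Multiplicative (Fin g → ZMod n) ≃* H) (ψ : Multiplicative (Fin g → ZMod n) ≃* H') :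
    ∃ F : Coord n g ≃* Q, (∀ i, F (coordX n i) ∈ H) ∧ (∀ i, F (coordY n i) ∈ H') ∧
      ∀ i j, X.pairing (F (coordX n i)) (F (coordY n j)) =
        if i = j then rootUnit kbar hζ else 1 := by
  let x : Fin g → Q := fun i => φ (Multiplicative.ofAdd (Pi.single i 1))
  have hφ : ∀ s : Multiplicative (Fin g → ZMod n), (φ s : Q) = ∏ i, x i ^ (s.toAdd i).val := by
    intro s
    let f : (Fin g → Multiplicative (ZMod n)) →* Multiplicative (Fin g → ZMod n) :=
      { toFun := fun t => Multiplicative.ofAdd fun i => (t i).toAdd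
        map_one' := rfl
        map_mul' := fun _ _ => rfl }
    have hf : ∀ i, f (stdGen n i) = Multiplicative.ofAdd (Pi.single i 1) := fun i =>
      congrArg (fun c : Coord n g => Multiplicative.ofAdd c.toAdd.1) (coordInl_stdGen i)
    have := map_eq_prod_stdGen ((H.subtype.comp φ.toMonoidHom).comp f)
      (fun i => Multiplicative.ofAdd (s.toAdd i))
    simp only [MonoidHom.comp_apply, hf] at this
    exact this
  have hxn : ∀ i, x i ^ n = 1 := fun i => by
    have : (φ (Multiplicative.ofAdd (Pi.single i 1)) ^ n : H) = 1 := by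
      rw [← map_pow, ← ofAdd_nsmul, ← map_one φ]
      refine congrArg φ (congrArg Multiplicative.ofAdd (funext fun j => ?_))
      simp
    exact congrArg Subtype.val this
  have hlog : ∀ (y : H') (i : Fin g), ∃ d : ZMod n,
      X.pairing (x i) y = rootUnit kbar hζ ^ d.val := fun y i =>
    exists_eq_rootUnit_pow hζ (by
      rw [← MonoidHom.pow_apply, ← map_pow, hxn, map_one, MonoidHom.one_apply])
  choose d hd using hlog
  -- `D y` lists the discrete logarithms of the values `e(xᵢ, y)`; the preimages of the standard
  -- vectors under `D` will be the `yⱼ`.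
  let D : H' →* Multiplicative (Fin g → ZMod n) := MonoidHom.mk' (fun y => Multiplicative.ofAdd (d y))
    fun y y' => congrArg Multiplicative.ofAdd (funext fun i =>
      (isPrimitiveRoot_rootUnit (kbar := kbar) hζ).pow_zmod_val_injective (by
        change rootUnit kbar hζ ^ (d (y * y') i).val = rootUnit kbar hζ ^ (d y i + d y' i).val
        rw [pow_zmod_val_add (rootUnit_pow hζ), ← hd, ← hd, ← hd, ← map_mul]
        rfl))
  have hDi : Function.Injective D := by
    rw [injective_iff_map_eq_one]
    intro y hy
    have hy' : d y = 0 := hy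
    refine Subtype.ext (X.eq_one_of_mem_left hX hc.codisjoint.symm hH' y.2 fun R hR => ?_)
    obtain ⟨s, hs⟩ := φ.surjective ⟨R, hR⟩
    have hR' : R = ∏ i, x i ^ (s.toAdd i).val := by rw [← hφ, hs]
    rw [X.pairing_swap, inv_eq_one, hR', map_prod, MonoidHom.finsetProd_apply]
    refine Finset.prod_eq_one fun i _ => ?_
    rw [map_pow, MonoidHom.pow_apply, hd, hy']
    simp
  have : Finite H' := Finite.of_equiv _ ψ.toEquiv
  -- An injection between finite groups of equal order is a bijection.
  have hDb : Function.Bijective D :=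
    hDi.bijective_of_nat_card_le (Nat.card_congr ψ.toEquiv).le
  let D' := MulEquiv.ofBijective D hDb
  let F : Coord n g →* Q := MonoidHom.mk'
    (fun s => φ (Multiplicative.ofAdd s.toAdd.1) * D'.symm (Multiplicative.ofAdd s.toAdd.2))
    fun s t => by
      rw [toAdd_mul, Prod.fst_add, Prod.snd_add, ofAdd_add, ofAdd_add, map_mul, map_mul,
        Subgroup.coe_mul, Subgroup.coe_mul, mul_mul_mul_comm]
  have hF : ∀ s, F s =
    φ (Multiplicative.ofAdd s.toAdd.1) * D'.symm (Multiplicative.ofAdd s.toAdd.2) := fun _ => rfl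
  have hFb : Function.Bijective F := by
    constructor
    · rw [injective_iff_map_eq_one]
      intro s hs
      rw [hF, mul_eq_one_iff_eq_inv] at hs
      have h1 : (φ (Multiplicative.ofAdd s.toAdd.1) : Q) = 1 :=
        Subgroup.disjoint_def.mp hc.disjoint (SetLike.coe_mem _)
          (by rw [hs]; exact H'.inv_mem (SetLike.coe_mem _))
      rw [h1, eq_comm, inv_eq_one] at hs
      have h2 := (map_eq_one_iff φ φ.injective).mp (Subtype.ext h1)
      have h3 := (map_eq_one_iff D'.symm D'.symm.injective).mp (Subtype.ext hs)
      exact congrArg Multiplicative.ofAdd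
        (Prod.ext (congrArg Multiplicative.toAdd h2) (congrArg Multiplicative.toAdd h3))
    · intro q
      obtain ⟨a, ha, b, hb, rfl⟩ := Subgroup.mem_sup.mp
        (hc.codisjoint.eq_top.ge (Subgroup.mem_top q))
      refine ⟨Multiplicative.ofAdd ((φ.symm ⟨a, ha⟩).toAdd, (D' ⟨b, hb⟩).toAdd), ?_⟩
      rw [hF]
      simp
  have hFx : ∀ i, F (coordX n i) = x i := fun i => by
    rw [hF, coordX, toAdd_ofAdd, ofAdd_zero, map_one, Subgroup.coe_one, mul_one]
  have hFy : ∀ j, F (coordY n j) = D'.symm (Multiplicative.ofAdd (Pi.single j 1)) := fun j => by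
    rw [hF, coordY, toAdd_ofAdd, ofAdd_zero, map_one, Subgroup.coe_one, one_mul]
  refine ⟨MulEquiv.ofBijective F hFb, fun i => ?_, fun i => ?_, fun i j => ?_⟩
  · rw [MulEquiv.ofBijective_apply, hFx]
    exact SetLike.coe_mem _
  · rw [MulEquiv.ofBijective_apply, hFy]
    exact SetLike.coe_mem _
  · rw [MulEquiv.ofBijective_apply, MulEquiv.ofBijective_apply, hFx, hFy, hd]
    have h : D (D'.symm (Multiplicative.ofAdd (Pi.single j 1))) =
      Multiplicative.ofAdd (Pi.single j 1) := D'.apply_symm_apply _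
    have h' : d (D'.symm (Multiplicative.ofAdd (Pi.single j 1))) = Pi.single j 1 := h
    rw [h']
    split_ifs with hij
    · subst hij
      have := pow_zmod_val_natCast (rootUnit_pow (kbar := kbar) hζ) 1
      rw [Nat.cast_one, pow_one] at this
      rw [Pi.single_eq_same, this]
    · rw [Pi.single_eq_of_ne hij, ZMod.val_zero, pow_zero]

/-- The `n`-th power of any lift is a scalar, and dividing the lift by an `n`-th root of that scalar
makes it `n`-torsion. -/
theorem exists_pow_eq_one_proj_eq [IsAlgClosure k kbar] {q : Q} (hq : q ^ n = 1) : ∃ e : E, e ^ n = 1 ∧ X.proj e = q := by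
  obtain ⟨e, rfl⟩ := X.proj_surjective q
  obtain ⟨c, hc⟩ := X.exists_of_proj_eq_one (e := e ^ n) (by rw [map_pow, hq])
  obtain ⟨r, rfl⟩ := exists_pow_eq_unit k n c
  refine ⟨X.incl r⁻¹ * e, ?_, by rw [map_mul, X.proj_incl, one_mul]⟩
  have : Commute (X.incl r⁻¹) e := X.central _ _
  rw [this.mul_pow, ← hc, ← map_pow, ← map_mul, inv_pow, inv_mul_cancel, map_one]

/-- A homomorphism from `(ℤ/n)^g` onto an isotropic subgroup lifts to the central extension. -/
theorem exists_hom_lift [IsAlgClosure k kbar] {q : Fin g → Q} (hq : ∀ i, q i ^ n = 1)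
    (hiso : ∀ i j, X.pairing (q i) (q j) = 1) :
    ∃ F : (Fin g → Multiplicative (ZMod n)) →* E, ∀ i, X.proj (F (stdGen n i)) = q i := by
  choose e he hp using fun i => X.exists_pow_eq_one_proj_eq (hq i)
  -- Isotropy makes the `n`-torsion lifts commute, so together they define a homomorphism on
  -- `(ℤ/n)^g`.
  have hcomm : ∀ i j, Commute (e i) (e j) := fun i j =>
    X.commute_of_pairing_eq_one (by rw [hp, hp, hiso])
  have hpair : Pairwise fun i j => ∀ a b, Commute (powZMod (he i) a) (powZMod (he j) b) :=
    fun i j _ a b => (hcomm i j).pow_pow _ _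
  refine ⟨MonoidHom.noncommPiCoprod (fun i => powZMod (he i)) hpair, fun i => ?_⟩
  rw [stdGen, MonoidHom.noncommPiCoprod_mulSingle, powZMod_ofAdd, ← hp]
  have := pow_zmod_val_natCast (he i) 1
  rw [Nat.cast_one, pow_one] at this
  rw [this]

/-- The Galois action on a lift of a constant subgroup is given by characters. -/
theorem exists_characters (F : (Fin g → Multiplicative (ZMod n)) →* E)
    (hF : ∀ (σ : AbsGal k kbar) s, σ • X.proj (F s) = X.proj (F s)) :
    ∃ u : Fin g → Character (AbsGal k kbar) n, ∀ (σ : AbsGal k kbar) s,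
      σ • F s = X.incl (∏ i, rootUnit kbar hζ ^ (u i σ * (s i).toAdd).val) * F s := by
  have hex : ∀ (σ : AbsGal k kbar) s, ∃ c, X.incl c = σ • F s * (F s)⁻¹ := fun σ s =>
    X.exists_of_proj_eq_one (by rw [map_mul, map_inv, X.proj_smul, hF, mul_inv_cancel])
  choose w hw using hex
  have hw' : ∀ σ s, σ • F s = X.incl (w σ s) * F s := fun σ s => by rw [hw, inv_mul_cancel_right]
  -- Both `F` and the action of `σ` are multiplicative and the factors `w` are central, so `w σ` is
  -- a homomorphism, determined by its values on generators.
  have hwmul : ∀ σ s t, w σ (s * t) = w σ s * w σ t := fun σ s t => by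
    apply X.incl_injective
    rw [hw, map_mul F, smul_mul', hw', hw', map_mul, mul_assoc (X.incl (w σ s)),
      ← mul_assoc (F s), ← X.central (w σ t) (F s)]
    group
  let W : AbsGal k kbar → (Fin g → Multiplicative (ZMod n)) →* kbarˣ := fun σ =>
    MonoidHom.mk' (w σ) (hwmul σ)
  have hlog : ∀ (i : Fin g) (σ : AbsGal k kbar), ∃ d : ZMod n,
      w σ (stdGen n i) = rootUnit kbar hζ ^ d.val := fun i σ =>
    exists_eq_rootUnit_pow hζ (by
      change W σ _ ^ n = 1
      rw [← map_pow, stdGen_pow, map_one])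
  choose d hd using hlog
  have hinj := (isPrimitiveRoot_rootUnit (kbar := kbar) hζ).pow_zmod_val_injective
  refine ⟨fun i => ⟨d i, ?_, fun σ τ => hinj ?_⟩, fun σ s => ?_⟩
  · refine IsLocallyConstant.desc (d i)
      (fun j => X.incl (rootUnit kbar hζ ^ j.val)) ?_ (X.incl_injective.comp hinj)
    have : (fun j : ZMod n => X.incl (rootUnit kbar hζ ^ j.val)) ∘ d i =
        fun σ => σ • F (stdGen n i) * (F (stdGen n i))⁻¹ := funext fun σ => by
      rw [Function.comp_apply, ← hd, hw]
    rw [this]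
    exact (X.isLocallyConstant_smul _).comp fun e => e * (F (stdGen n i))⁻¹
  -- In general `w` is a cocycle in `σ`; its values on generators are powers of `ζ`, which Galois
  -- fixes, so the exponents are additive.
  · beta_reduce
    rw [pow_zmod_val_add (rootUnit_pow hζ), ← hd, ← hd, ← hd]
    apply X.incl_injective
    rw [hw, mul_smul, hw' τ, smul_mul', ← X.incl_smul, hd i τ, smul_rootUnit_pow, ← hd, hw' σ,
      map_mul, ← mul_assoc, mul_inv_cancel_right, X.central]
  · rw [hw']
    congr 2
    change W σ s = _
    rw [map_eq_prod_stdGen]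
    refine Finset.prod_congr rfl fun i _ => ?_
    change w σ _ ^ _ = rootUnit kbar hζ ^ (d i σ * _).val
    rw [hd, pow_zmod_val_mul (rootUnit_pow hζ)]

theorem pairing_eq_prod {F G : (Fin g → Multiplicative (ZMod n)) →* Q}
    (h : ∀ i j, X.pairing (F (stdGen n i)) (G (stdGen n j)) =
      if i = j then rootUnit kbar hζ else 1) (s t : Fin g → Multiplicative (ZMod n)) :
    X.pairing (F s) (G t) = ∏ i, rootUnit kbar hζ ^ ((t i).toAdd * (s i).toAdd).val := by
  have h1 : ∀ i, X.pairing (F (stdGen n i)) (G t) = rootUnit kbar hζ ^ (t i).toAdd.val := by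
    intro i
    have := map_eq_prod_stdGen ((X.pairing (F (stdGen n i))).comp G) t
    simp only [MonoidHom.comp_apply, h] at this
    rw [this, Finset.prod_eq_single i (fun j _ hj => by rw [if_neg hj.symm, one_pow]) (by simp),
      if_pos rfl]
  have := map_eq_prod_stdGen ((X.pairing.flip (G t)).comp F) s
  simp only [MonoidHom.comp_apply, MonoidHom.flip_apply, h1] at this
  rw [this]
  simp only [pow_zmod_val_mul (rootUnit_pow hζ)]

/-- The coboundary of `N = F · G`: the central scalars `a`, `b` come from the Galois action on the
lifts, and moving `f₂` to the left past `g₁` costs `c⁻¹`. -/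
theorem boundary_mul_eq {E : Type*} [Group E] {a b c f₁ g₁ f₂ g₂ : E} (ha : ∀ e, a * e = e * a)
    (hb : ∀ e, b * e = e * b) (hc : f₂ * g₁ * f₂⁻¹ * g₁⁻¹ = c) (hc' : ∀ e, c * e = e * c) :
    f₁ * g₁ * (a * f₂ * (b * g₂)) * (f₁ * f₂ * (g₁ * g₂))⁻¹ = a * b * c⁻¹ := by
  rw [mul_inv_eq_iff_eq_mul, eq_comm]
  have h1 : f₂ * g₁ = c * (g₁ * f₂) := by rw [← hc]; group
  calc a * b * c⁻¹ * (f₁ * f₂ * (g₁ * g₂)) = a * b * c⁻¹ * (f₁ * (f₂ * g₁) * g₂) := by group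
    _ = a * b * c⁻¹ * ((f₁ * c) * (g₁ * f₂) * g₂) := by rw [h1]; group
    _ = a * b * (f₁ * g₁ * f₂ * g₂) := by rw [← hc']; group
    _ = (f₁ * g₁ * a) * f₂ * b * g₂ := by rw [← ha, mul_assoc a, hb]; simp only [mul_assoc, hb]
    _ = _ := by group

/-- The connecting map of a central extension with constant quotient and a symplectic basis is the
sum of a quadratic form and a linear form in the coordinate characters. -/
theorem exists_connecting_eq [IsAlgClosure k kbar]
    (htriv : ∀ (σ : AbsGal k kbar) (P : Q), σ • P = P)
    (B : Coord n g ≃* Q)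
    (hx : ∀ i j, X.pairing (B (coordX n i)) (B (coordX n j)) = 1)
    (hy : ∀ i j, X.pairing (B (coordY n i)) (B (coordY n j)) = 1)
    (hxy : ∀ i j, X.pairing (B (coordX n i)) (B (coordY n j)) =
      if i = j then rootUnit kbar hζ else 1) :
    ∃ u v : Fin g → Character (AbsGal k kbar) n,
      ∀ (s t : Fin g → Character (AbsGal k kbar) n) (ξ : Z1 (AbsGal k kbar) Q),
        (∀ σ, ξ.1 σ = B (Multiplicative.ofAdd (fun i => s i σ, fun i => t i σ))) →
        (Additive.ofMul (X.connecting (QuotientGroup.mk ξ)) : Br k kbar) =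
          ∑ i, (cup hζ (u i) (s i) + cup hζ (v i) (t i) + -cup hζ (t i) (s i)) := by
  have hpow : ∀ q : Coord n g, B q ^ n = 1 := fun q => by rw [← map_pow, coord_pow, map_one]
  obtain ⟨F, hF⟩ := X.exists_hom_lift (fun i => hpow (coordX n i)) hx
  obtain ⟨G, hG⟩ := X.exists_hom_lift (fun i => hpow (coordY n i)) hy
  obtain ⟨u, hu⟩ := X.exists_characters hζ F fun σ s => htriv σ _
  obtain ⟨v, hv⟩ := X.exists_characters hζ G fun σ s => htriv σ _
  have hFB : X.proj.comp F = B.toMonoidHom.comp (coordInl n g) := hom_ext_stdGen fun i => by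
    change X.proj (F _) = B _
    rw [hF, coordInl_stdGen]
  have hGB : X.proj.comp G = B.toMonoidHom.comp (coordInr n g) := hom_ext_stdGen fun i => by
    change X.proj (G _) = B _
    rw [hG, coordInr_stdGen]
  have hFG := X.pairing_eq_prod hζ (F := X.proj.comp F) (G := X.proj.comp G) fun i j => by
    rw [MonoidHom.comp_apply, MonoidHom.comp_apply, hF, hG, hxy]
  refine ⟨u, v, fun s t ξ hξ => ?_⟩
  let S : AbsGal k kbar → Fin g → Multiplicative (ZMod n) :=
    fun σ i => Multiplicative.ofAdd (s i σ)
  let R : AbsGal k kbar → Fin g → Multiplicative (ZMod n) :=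
    fun σ i => Multiplicative.ofAdd (t i σ)
  have hS : ∀ σ τ, S (σ * τ) = S σ * S τ := fun σ τ => funext fun i =>
    congrArg Multiplicative.ofAdd ((s i).2.2 σ τ)
  have hR : ∀ σ τ, R (σ * τ) = R σ * R τ := fun σ τ => funext fun i =>
    congrArg Multiplicative.ofAdd ((t i).2.2 σ τ)
  let c : Z2 (AbsGal k kbar) kbarˣ :=
    ∏ i, (cupCocycle hζ (u i) (s i) * cupCocycle hζ (v i) (t i) * (cupCocycle hζ (t i) (s i))⁻¹)
  have hcv : ∀ σ τ, c.1 (σ, τ) = (∏ i, rootUnit kbar hζ ^ (u i σ * s i τ).val) *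
      (∏ i, rootUnit kbar hζ ^ (v i σ * t i τ).val) *
        (∏ i, rootUnit kbar hζ ^ (t i σ * s i τ).val)⁻¹ := fun σ τ => by
    rw [← Finset.prod_inv_distrib, ← Finset.prod_mul_distrib, ← Finset.prod_mul_distrib]
    change (Subgroup.subtype _ c) (σ, τ) = _
    rw [map_prod, Finset.prod_apply]
    rfl
  have hlc : ∀ r : Fin g → Character (AbsGal k kbar) n,
      IsLocallyConstant fun (σ : AbsGal k kbar) (i : Fin g) => Multiplicative.ofAdd (r i σ) := by
    intro r
    rw [IsLocallyConstant.iff_eventually_eq]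
    intro σ
    filter_upwards [Filter.eventually_all.mpr fun i => (r i).2.1.eventually_eq σ] with τ hτ
    exact funext fun i => congrArg Multiplicative.ofAdd (hτ i)
  -- The commutator is that of `F(s(τ))` with `G(t(σ))`, which is why the last factor is `t ∪ s`
  -- with a minus sign.
  have hb : X.IsBoundaryOf c.1 fun σ => F (S σ) * G (R σ) := fun σ τ => by
    beta_reduce
    rw [hcv, smul_mul', hu, hv, hS, hR, map_mul F, map_mul G]
    have hp := X.pairing_proj (F (S τ)) (G (R σ))
    have hfg := hFG (S τ) (R σ)
    rw [MonoidHom.comp_apply, MonoidHom.comp_apply] at hfg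
    rw [boundary_mul_eq (X.central _) (X.central _) hp.symm (X.central _), hfg, ← map_mul,
      ← map_inv, ← map_mul]
    rfl
  rw [X.connecting_eq_of_isBoundaryOf (((hlc s).comp F).mul ((hlc t).comp G)) hb ξ fun σ => by
    change X.proj (F (S σ) * G (R σ)) = _
    rw [hξ, ← coordInl_mul_coordInr, map_mul, map_mul]
    exact congrArg₂ (· * ·) (DFunLike.congr_fun hFB _) (DFunLike.congr_fun hGB _)]
  change Additive.ofMul (QuotientGroup.mk' _ c) = _
  rw [map_prod, ofMul_prod]
  refine Finset.sum_congr rfl fun i _ => ?_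
  rfl

end Galois

end GaloisCohomology.CentralExtension

/-! ### `H¹` of a constant module, and completion of the bilinear form -/

namespace GaloisCohomology

/-- Under a trivial action every coboundary is trivial, so a class has only one cocycle. -/
theorem mk_eq_mk_iff_of_smul_eq {Γ M : Type*} [Group Γ] [TopologicalSpace Γ] [CommGroup M]
    [MulDistribMulAction Γ M] (htriv : ∀ (σ : Γ) (m : M), σ • m = m) {ξ ξ' : Z1 Γ M} :
    (QuotientGroup.mk ξ : H1 Γ M) = QuotientGroup.mk ξ' ↔ ξ = ξ' := by
  refine ⟨fun h => ?_, fun h => by rw [h]⟩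
  obtain ⟨m, hm⟩ := QuotientGroup.eq.mp h
  rw [← inv_mul_eq_one]
  refine Subtype.ext (funext fun σ => ?_)
  exact (hm σ).symm.trans (by rw [htriv, div_self']; rfl)

section Kummer

variable {k kbar Q : Type*} [Field k] [Field kbar] [Algebra k kbar] [IsAlgClosure k kbar]
  [CommGroup Q] [MulDistribMulAction (AbsGal k kbar) Q] {n g : ℕ} [NeZero n]
  {ζ : k} (hζ : IsPrimitiveRoot ζ n)

/-- Kummer theory for a constant module `(ℤ/n)^g ⊕ (ℤ/n)^g`. -/
theorem exists_H1_equiv [PerfectField k] (htriv : ∀ (σ : AbsGal k kbar) (P : Q), σ • P = P)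
    (B : Coord n g ≃* Q) :
    ∃ β : H1 (AbsGal k kbar) Q ≃* (Fin g → UnitsModPow k n) × (Fin g → UnitsModPow k n),
      ∀ (ξ : Z1 (AbsGal k kbar) Q) (a b : Fin g → UnitsModPow k n),
        β (QuotientGroup.mk ξ) = (a, b) ↔ ∀ σ, ξ.1 σ = B (Multiplicative.ofAdd
          (fun i => kummer kbar hζ (a i) σ, fun i => kummer kbar hζ (b i) σ)) := by
  let κ : (Fin g → UnitsModPow k n) × (Fin g → UnitsModPow k n) → AbsGal k kbar → Q :=
    fun a σ => B (Multiplicative.ofAdd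
      (fun i => kummer kbar hζ (a.1 i) σ, fun i => kummer kbar hζ (a.2 i) σ))
  have hκ : ∀ a, κ a ∈ Z1 (AbsGal k kbar) Q := fun a => by
    constructor
    · rw [IsLocallyConstant.iff_eventually_eq]
      intro σ
      filter_upwards [Filter.eventually_all.mpr fun i =>
          (kummer kbar hζ (a.1 i)).2.1.eventually_eq σ,
        Filter.eventually_all.mpr fun i =>
          (kummer kbar hζ (a.2 i)).2.1.eventually_eq σ] with τ h1 h2
      exact congrArg (fun p => B (Multiplicative.ofAdd p)) (Prod.ext (funext h1) (funext h2))
    · intro σ τ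
      rw [htriv, mul_comm, ← map_mul, ← ofAdd_add]
      exact congrArg (fun p => B (Multiplicative.ofAdd p)) (Prod.ext
        (funext fun i => (kummer kbar hζ (a.1 i)).2.2 σ τ)
        (funext fun i => (kummer kbar hζ (a.2 i)).2.2 σ τ))
  let f : (Fin g → UnitsModPow k n) × (Fin g → UnitsModPow k n) →* H1 (AbsGal k kbar) Q :=
    (QuotientGroup.mk' _).comp (MonoidHom.mk' (fun a => (⟨κ a, hκ a⟩ : Z1 (AbsGal k kbar) Q))
      fun a b => Subtype.ext (funext fun σ => by
        change κ (a * b) σ = κ a σ * κ b σ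
        rw [← map_mul, ← ofAdd_add]
        exact congrArg (fun p => B (Multiplicative.ofAdd p)) (Prod.ext
          (funext fun i => kummer_mul hζ (a.1 i) (b.1 i) σ)
          (funext fun i => kummer_mul hζ (a.2 i) (b.2 i) σ))))
  have hf : ∀ (ξ : Z1 (AbsGal k kbar) Q) a, QuotientGroup.mk ξ = f a ↔ ∀ σ, ξ.1 σ = κ a σ :=
    fun ξ a => (mk_eq_mk_iff_of_smul_eq htriv (ξ := ξ) (ξ' := ⟨κ a, hκ a⟩)).trans
      (Subtype.ext_iff.trans funext_iff)
  have hfb : Function.Bijective f := by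
    constructor
    · intro a b hab
      have h : ∀ σ, κ a σ = κ b σ := (hf ⟨κ a, hκ a⟩ b).mp hab
      have h' := fun σ => congrArg Multiplicative.toAdd (B.injective (h σ))
      exact Prod.ext
        (funext fun i => kummer_injective (kbar := kbar) hζ fun σ =>
          congrFun (congrArg Prod.fst (h' σ)) i)
        (funext fun i => kummer_injective (kbar := kbar) hζ fun σ =>
          congrFun (congrArg Prod.snd (h' σ)) i)
    · intro y
      induction y using QuotientGroup.induction_on with | H ξ =>
      -- Under the trivial action a cocycle is a homomorphism, so each of its coordinates is a
      -- character, to which Kummer theory applies.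
      have hm : ∀ σ τ, (B.symm (ξ.1 (σ * τ))).toAdd =
          (B.symm (ξ.1 σ)).toAdd + (B.symm (ξ.1 τ)).toAdd := fun σ τ => by
        rw [ξ.2.2 σ τ, htriv, mul_comm, map_mul, toAdd_mul]
      choose a ha using fun i : Fin g => exists_kummer_eq (kbar := kbar) hζ
        ⟨fun σ => (B.symm (ξ.1 σ)).toAdd.1 i, ξ.2.1.comp fun q => (B.symm q).toAdd.1 i,
          fun σ τ => by beta_reduce; rw [hm]; rfl⟩
      choose b hb using fun i : Fin g => exists_kummer_eq (kbar := kbar) hζ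
        ⟨fun σ => (B.symm (ξ.1 σ)).toAdd.2 i, ξ.2.1.comp fun q => (B.symm q).toAdd.2 i,
          fun σ τ => by beta_reduce; rw [hm]; rfl⟩
      refine ⟨(a, b), ((hf ξ (a, b)).mpr fun σ => ?_).symm⟩
      rw [← B.symm_apply_eq]
      exact congrArg Multiplicative.ofAdd (Prod.ext (funext fun i => (ha i σ).symm)
        (funext fun i => (hb i σ).symm))
  refine ⟨(MulEquiv.ofBijective f hfb).symm, fun ξ a b => ?_⟩
  rw [MulEquiv.symm_apply_eq]
  exact hf ξ (a, b)

end Kummer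

/-- Completing a bilinear form plus a linear form to a shifted bilinear form. -/
theorem sum_bilinear_shift {I U A : Type*} [Mul U] [AddCommGroup A] (s : Finset I)
    {φ : U → U → A} (hl : ∀ a a' b, φ (a * a') b = φ a b + φ a' b)
    (hr : ∀ a b b', φ a (b * b') = φ a b + φ a b') (c d a b : I → U) :
    ∑ i ∈ s, (φ (c i * a i) (d i * b i) - φ (c i) (d i)) =
      ∑ i ∈ s, φ (a i) (b i) + ∑ i ∈ s, (φ (c i) (b i) + φ (a i) (d i)) := by
  rw [← Finset.sum_add_distrib]
  refine Finset.sum_congr rfl fun i _ => ?_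
  rw [hl, hr, hr]
  abel

end GaloisCohomology

/-! ### Theta groups and the main theorem -/

namespace ThetaGroups.AbstractThetaGroup

variable {k kbar : Type u} [Field k] [Field kbar] [Algebra k kbar] [IsAlgClosure k kbar]
  (T : AbstractThetaGroup k kbar)

theorem center_le_range_incl :
    Subgroup.center (Pt kbar T.G) ≤ T.centralExtension.incl.range := by
  rw [T.center_eq]
  rintro _ ⟨p, rfl⟩
  refine ⟨(gmPt k kbar).symm p, ?_⟩
  change ptMap kbar T.incl (gmPt k kbar ((gmPt k kbar).symm p)) = _
  rw [MulEquiv.apply_symm_apply]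

theorem LagrangianStructure.smul_eq {T : AbstractThetaGroup k kbar} (L : T.LagrangianStructure)
    {n g : ℕ} (hH : T.IsConstant n g L.H) (hHdual : T.IsConstant n g L.Hdual)
    (σ : AbsGal k kbar) (P : Pt kbar T.K) : σ • P = P := by
  obtain ⟨P₁, h₁, P₂, h₂, rfl⟩ := Subgroup.mem_sup.mp
    (L.isCompl.codisjoint.eq_top.ge (Subgroup.mem_top P))
  rw [smul_mul', hH.2 σ _ h₁, hHdual.2 σ _ h₂]

end ThetaGroups.AbstractThetaGroup

theorem theorem26 {k kbar : Type u} [Field k] [PerfectField k] [Field kbar] [Algebra k kbar]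
    [IsAlgClosure k kbar] (n g : ℕ) [NeZero n] (hg : 0 < g)
    (T : AbstractThetaGroup k kbar) (hT : T.IsOfType n g)
    (L : T.LagrangianStructure) (hH : T.IsConstant n g L.H) (hHdual : T.IsConstant n g L.Hdual) :
    (∃ ζ : k, IsPrimitiveRoot ζ n) ∧
    ∀ (ζ : k) (hζ : IsPrimitiveRoot ζ n),
      (∃ B : T.SymplecticBasis n g ζ, ∀ i, B.x i ∈ L.H ∧ B.y i ∈ L.Hdual) ∧
      ∀ B : T.SymplecticBasis n g ζ,
        ∃ β : H1 (AbsGal k kbar) (Pt kbar T.K) ≃*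
            (Fin g → UnitsModPow k n) × (Fin g → UnitsModPow k n),
          (∀ (ξ : Z1 (AbsGal k kbar) (Pt kbar T.K)) (a b : Fin g → UnitsModPow k n),
            β (QuotientGroup.mk ξ) = (a, b) ↔
              ∀ σ, ξ.1 σ = B.equiv (Multiplicative.ofAdd
                (fun i => kummer kbar hζ (a i) σ, fun i => kummer kbar hζ (b i) σ))) ∧
          ∃ C₁ C₂ : Fin g → UnitsModPow k n, ∀ a b : Fin g → UnitsModPow k n,
            T.obstruction (β.symm (a, b)) =
                ∑ i, (normResidue kbar hζ (C₁ i * a i) (C₂ i * b i) -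
                  normResidue kbar hζ (C₁ i) (C₂ i)) ∧
            T.obstruction (β.symm (a, b)) =
                (∑ i, normResidue kbar hζ (a i) (b i)) +
                  ∑ i, (normResidue kbar hζ (C₁ i) (b i) + normResidue kbar hζ (a i) (C₂ i)) := by
  have htriv := L.smul_eq hH hHdual
  have hX := T.center_le_range_incl
  obtain ⟨E⟩ := hT
  obtain ⟨φ⟩ := hH.1
  obtain ⟨ψ⟩ := hHdual.1
  constructor
  · have : Finite (Pt kbar T.K) := Finite.of_equiv _ E.toEquiv
    -- As `g > 0`, there is a standard generator of `(ℤ/n)^g`; its image in `H` has order exactly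
    -- `n`.
    let i₀ : Fin g := ⟨0, hg⟩
    refine T.centralExtension.exists_isPrimitiveRoot hX htriv L.isCompl.codisjoint L.isotropic_H
      (x := φ (Multiplicative.ofAdd (Pi.single i₀ 1))) (SetLike.coe_mem _) ?_
    rw [Subgroup.orderOf_coe, MulEquiv.orderOf_eq, orderOf_ofAdd_eq_addOrderOf,
      ← AddMonoidHom.single_apply, addOrderOf_injective (AddMonoidHom.single (fun _ : Fin g => ZMod n) i₀)
        (Pi.single_injective (M := fun _ : Fin g => ZMod n) i₀),
      ZMod.addOrderOf_one]
  intro ζ hζ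
  constructor
  · obtain ⟨F, hFx, hFy, hF⟩ := T.centralExtension.exists_symplectic_equiv hζ hX L.isCompl
      L.isotropic_Hdual φ ψ
    refine ⟨⟨F, fun i j => L.isotropic_H _ (hFx i) _ (hFx j),
      fun i j => L.isotropic_Hdual _ (hFy i) _ (hFy j), fun i j => ?_⟩, fun i => ⟨hFx i, hFy i⟩⟩
    refine (congrArg Units.val (hF i j)).trans ?_
    split_ifs <;> rfl
  intro B
  obtain ⟨β, hβ⟩ := exists_H1_equiv (kbar := kbar) hζ htriv B.equiv
  refine ⟨β, hβ, ?_⟩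
  -- Only the symplectic relations of `B` enter here, so `B` need not be adapted to the Lagrangian
  -- decomposition.
  obtain ⟨u, v, huv⟩ := T.centralExtension.exists_connecting_eq hζ htriv B.equiv B.e_x_x B.e_y_y
    fun i j => Units.ext ((B.e_x_y i j).trans (by split_ifs <;> rfl))
  choose U hU using fun i => exists_kummer_eq hζ (u i)
  choose V hV using fun i => exists_kummer_eq hζ (v i)
  have hU' : ∀ i, u i = kummer kbar hζ (U i) := fun i => Subtype.ext (funext fun σ => (hU i σ).symm)
  have hV' : ∀ i, v i = kummer kbar hζ (V i) := fun i => Subtype.ext (funext fun σ => (hV i σ).symm)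
  -- From `χ_V ∪ χ_b = -⟨b, V⟩ = ⟨V, b⟩` and `χ_U ∪ χ_a = -⟨a, U⟩ = ⟨a, U⁻¹⟩`: the constants are `C₁
  -- = V` and `C₂ = U⁻¹`.
  refine ⟨V, fun i => (U i)⁻¹, fun a b => ?_⟩
  have key : T.obstruction (β.symm (a, b)) =
      (∑ i, normResidue kbar hζ (a i) (b i)) +
        ∑ i, (normResidue kbar hζ (V i) (b i) + normResidue kbar hζ (a i) (U i)⁻¹) := by
    obtain ⟨ξ, hξ⟩ := QuotientGroup.mk_surjective (β.symm (a, b))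
    have h := huv (fun i => kummer kbar hζ (a i)) (fun i => kummer kbar hζ (b i)) ξ
      ((hβ ξ a b).mp (by rw [hξ, MulEquiv.apply_symm_apply]))
    rw [← hξ]
    refine h.trans ?_
    rw [← Finset.sum_add_distrib]
    refine Finset.sum_congr rfl fun i _ => ?_
    rw [normResidue_inv_right, normResidue_swap hζ (V i), normResidue_eq_neg_cup,
      normResidue_eq_neg_cup, normResidue_eq_neg_cup, hU', hV']
    have gen : ∀ {A : Type u} [AddCommGroup A] (x y z : A), x + y + -z = -z + (- -y + - -x) := by
      intro A _ x y z
      abel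
    exact gen (A := Br k kbar) _ _ _
  exact ⟨key.trans (sum_bilinear_shift (U := UnitsModPow k n) (A := Br k kbar) Finset.univ
    (φ := normResidue kbar hζ) (normResidue_mul_left hζ) (normResidue_mul_right hζ)
    V (fun i => (U i)⁻¹) a b).symm, key⟩
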